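/- Let $k,m,n\ge 0$ be integers with $k\le\min(m,n)$, let $Z$ be a set of positions of an $m\times n$ matrix, and let $X=(X_{a,b})$ be a random $m\times n$ matrix (defined on some probability space) such that $X_{a,b}=0$ almost surely for $(a,b)\in Z$, while the entries $X_{a,b}$ with $(a,b)\notin Z$ are independent exponential random variables of intensity $1$. A $k$-assignment is a set of $k$ matrix positions, no two of them in the same row or in the same column; it is optimal if the sum of the entries of $X$ in its positions is minimal among all $k$-assignments. A set of rows and columns covers $Z$ if every position in $Z$ lies in one of these rows or columns. A partial $(k-1)$-cover is a subset of some set that consists of exactly $k-1$ rows and columns and covers $Z$ (for $k=0$ there are none). Let $r$ be a row that contains no position of $Z$, and let $\overline{d}_{i,0}$ be the number of partial $(k-1)$-covers that consist of $i$ rows and no columns and do not contain $r$. Then the probability that some element of row $r$ belongs to the optimal $k$-assignment is $$\frac1m\sum_{i=0}^{k-1}\frac{\overline{d}_{i,0}}{\binom{m-1}{i}} .$$ The optimal $k$-assignment need not be unique; the formula holds both for the probability that some optimal $k$-assignment uses row $r$ and for the probability that every optimal $k$-assignment uses row $r$. -/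

import Mathlib

open MeasureTheory ProbabilityTheory

namespace RandomAssignment

/-- A `k`-assignment: a set of `k` matrix positions, no two in the same row or column. -/
structure IsAssignment {m n : ℕ} (k : ℕ) (s : Finset (Fin m × Fin n)) : Prop where
  card_eq : s.card = k
  rows : Set.InjOn Prod.fst (s : Set (Fin m × Fin n))
  cols : Set.InjOn Prod.snd (s : Set (Fin m × Fin n))

/-- The sum of the entries of `A` in the positions of `s`. -/
def cost {m n : ℕ} (A : Fin m → Fin n → ℝ) (s : Finset (Fin m × Fin n)) : ℝ :=
  ∑ p ∈ s, A p.1 p.2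

/-- `s` is a `k`-assignment of minimal cost. -/
def IsOptimal {m n : ℕ} (A : Fin m → Fin n → ℝ) (k : ℕ) (s : Finset (Fin m × Fin n)) : Prop :=
  IsAssignment k s ∧ ∀ t : Finset (Fin m × Fin n), IsAssignment k t → cost A s ≤ cost A t

/-- Some element of the row `r` belongs to `s`. -/
def UsesRow {m n : ℕ} (s : Finset (Fin m × Fin n)) (r : Fin m) : Prop :=
  ∃ j : Fin n, (r, j) ∈ s

/-- The random `m × n` matrix `X`, with the number `k`, is a standard random assignment problem
with set of zeros `Z`: the entries in `Z` are zero, and the other entries are independent and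
exponentially distributed with intensity 1. -/
structure IsStandardRAP {Ω : Type*} [MeasurableSpace Ω] (μ : Measure Ω) {m n : ℕ} (k : ℕ)
    (Z : Finset (Fin m × Fin n)) (X : Fin m → Fin n → Ω → ℝ) : Prop where
  le_min : k ≤ min m n
  zero : ∀ p ∈ Z, ∀ᵐ ω ∂μ, X p.1 p.2 ω = 0
  law : ∀ p ∉ Z, HasLaw (X p.1 p.2) (expMeasure 1) μ
  indep : iIndepFun (fun p : {p : Fin m × Fin n // p ∉ Z} => X p.1.1 p.1.2) μ

/-- The rows in `R` together with the columns in `C` cover `Z`. -/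
def Covers {m n : ℕ} (Z : Finset (Fin m × Fin n)) (R : Finset (Fin m)) (C : Finset (Fin n)) :
    Prop :=
  ∀ p ∈ Z, p.1 ∈ R ∨ p.2 ∈ C

/-- `(R, C)` is a partial `(k-1)`-cover of `Z`: it is contained in a cover `(R', C')` consisting of
exactly `k - 1` rows and columns. For `k = 0` there are none. -/
def IsPartialCover {m n : ℕ} (Z : Finset (Fin m × Fin n)) (k : ℕ) (R : Finset (Fin m))
    (C : Finset (Fin n)) : Prop :=
  ∃ (R' : Finset (Fin m)) (C' : Finset (Fin n)),
    R ⊆ R' ∧ C ⊆ C' ∧ Covers Z R' C' ∧ R'.card + C'.card + 1 = k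

/-- The number of partial `(k-1)`-covers of `Z` with `i` rows and `j` columns that do not contain
the row `r`. -/
noncomputable def coverCoeffAvoiding {m n : ℕ} (Z : Finset (Fin m × Fin n)) (k : ℕ) (r : Fin m)
    (i j : ℕ) : ℕ :=
  Set.ncard {c : Finset (Fin m) × Finset (Fin n) |
    IsPartialCover Z k c.1 c.2 ∧ c.1.card = i ∧ c.2.card = j ∧ r ∉ c.1}

end RandomAssignment

/-! Almost surely the matrix is generic: it vanishes exactly on `Z`, and distinct sets of positions
outside `Z` have distinct costs. Optimal assignments of one size then differ only inside `Z`, and as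
row `r` has no zeros, "some" and "every" give almost surely the same event (`exists_usesRow_iff`).

The size j is treated as time. Let F_j be the set of rows used by all optimal j-assignments
(`commonRows`), and let t₀ be the largest size of an assignment inside `Z`. If t₀ ≥ k, both sides of
the formula vanish. For t₀ ≤ j < k, dual variables that are optimal for sizes j and j + 1 at once,
and positive on F_j (`exists_isPotential`), give the following facts. (1) F_j and the columns of the
zeros outside F_j are together exactly j lines (`card_commonRows_add`), whereas a cover that
contains F_j and one more row has more than j lines (`lt_card_cover`). (2) The nonzero positions of
optimal (j+1)-assignments outside the rows F_j all lie in one new row a (`existsUnique_newRow`).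
Given F_j, this row is uniform outside F_j, since exchanging a with another row outside F_j, in the
columns without zeros outside F_j, preserves the law and F_j (`swapRows_invariant`). (3) F_{j+1}
contains F_j ∪ {a}, and for j + 1 < k it belongs to a cover that is minimal among those containing
F_j ∪ {a}.

Now put the rows outside B in uniformly random order and let `orderProb` be the probability that B
and the rows before r extend to a cover with fewer than k lines (it is 1 if r ∈ B). Adding a
uniformly random row to B preserves its mean (`sum_orderProb_insert`). Enlarging F_j ∪ {a} to
F_{j+1} does not change it, by uncrossing of covers (`HasSmallCover.union`). So its expectation at
F_j does not depend on j: it starts at the value for B = ∅, which is the claimed sum, and at F_{k-1}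
∪ {a} it has become the indicator of r ∈ F_k. -/

namespace RandomAssignment

/-! ### Matchings: alternating paths and exchanges -/

section Matchings

variable {α β : Type*}

/-- A set of positions, no two in the same row or column. -/
structure IsMatching (s : Finset (α × β)) : Prop where
  rows : Set.InjOn Prod.fst (s : Set (α × β))
  cols : Set.InjOn Prod.snd (s : Set (α × β))

theorem IsMatching.subset {s t : Finset (α × β)} (hs : IsMatching s) (h : t ⊆ s) :
    IsMatching t :=
  ⟨hs.rows.mono (by exact_mod_cast h), hs.cols.mono (by exact_mod_cast h)⟩

theorem IsMatching.eq_of_fst {s : Finset (α × β)} (hs : IsMatching s) {p q : α × β} (hp : p ∈ s)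
    (hq : q ∈ s) (h : p.1 = q.1) : p = q :=
  hs.rows (by exact_mod_cast hp) (by exact_mod_cast hq) h

theorem IsMatching.eq_of_snd {s : Finset (α × β)} (hs : IsMatching s) {p q : α × β} (hp : p ∈ s)
    (hq : q ∈ s) (h : p.2 = q.2) : p = q :=
  hs.cols (by exact_mod_cast hp) (by exact_mod_cast hq) h

theorem exists_row_of_card_lt {s t : Finset (α × β)} (hs : IsMatching s)
    (h : t.card < s.card) : ∃ p ∈ s, ∀ q ∈ t, q.1 ≠ p.1 := by
  classical
  by_contra! hcon
  have : s.image Prod.fst ⊆ t.image Prod.fst := by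
    intro a ha
    obtain ⟨p, hp, rfl⟩ := Finset.mem_image.1 ha
    obtain ⟨q, hq, h⟩ := hcon p hp
    exact Finset.mem_image.2 ⟨q, hq, h⟩
  have h1 := Finset.card_le_card this
  rw [Finset.card_image_of_injOn hs.rows] at h1
  have := Finset.card_image_le (s := t) (f := Prod.fst)
  omega

variable [DecidableEq α] [DecidableEq β]

/-- The positions of `s` lie in the rows `R` exactly when they lie in the columns `C`. -/
def SplitsAt (s : Finset (α × β)) (R : Finset α) (C : Finset β) : Prop :=
  ∀ p ∈ s, p.1 ∈ R ↔ p.2 ∈ C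

/-- Replace the positions of `s` in the rows `R` by those of `t`. -/
def replaceOn (s t : Finset (α × β)) (R : Finset α) : Finset (α × β) :=
  {p ∈ s | p.1 ∉ R} ∪ {p ∈ t | p.1 ∈ R}

theorem IsMatching.replaceOn {s t : Finset (α × β)} (hs : IsMatching s) (ht : IsMatching t)
    {R : Finset α} {C : Finset β} (hsK : SplitsAt s R C) (htK : SplitsAt t R C) :
    IsMatching (replaceOn s t R) := by
  constructor
  · intro p hp q hq h
    simp only [RandomAssignment.replaceOn, Finset.coe_union, Set.mem_union, Finset.mem_coe,
      Finset.mem_filter] at hp hq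
    rcases hp with ⟨hp, hp'⟩ | ⟨hp, hp'⟩ <;> rcases hq with ⟨hq, hq'⟩ | ⟨hq, hq'⟩
    · exact hs.eq_of_fst hp hq h
    · exact absurd (h ▸ hq') hp'
    · exact absurd (h ▸ hp') hq'
    · exact ht.eq_of_fst hp hq h
  · intro p hp q hq h
    simp only [RandomAssignment.replaceOn, Finset.coe_union, Set.mem_union, Finset.mem_coe,
      Finset.mem_filter] at hp hq
    rcases hp with ⟨hp, hp'⟩ | ⟨hp, hp'⟩ <;> rcases hq with ⟨hq, hq'⟩ | ⟨hq, hq'⟩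
    · exact hs.eq_of_snd hp hq h
    · rw [hsK p hp, h, ← htK q hq] at hp'
      exact absurd hq' hp'
    · rw [hsK q hq, ← h, ← htK p hp] at hq'
      exact absurd hp' hq'
    · exact ht.eq_of_snd hp hq h

theorem sum_replaceOn {M : Type*} [AddCommMonoid M] (s t : Finset (α × β)) (R : Finset α)
    (f : α × β → M) :
    ∑ p ∈ replaceOn s t R, f p = ∑ p ∈ s with p.1 ∉ R, f p + ∑ p ∈ t with p.1 ∈ R, f p := by
  apply Finset.sum_union
  rw [Finset.disjoint_left]
  intro p hp hq
  exact (Finset.mem_filter.1 hp).2 (Finset.mem_filter.1 hq).2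

theorem card_replaceOn (s t : Finset (α × β)) (R : Finset α) :
    (replaceOn s t R).card = {p ∈ s | p.1 ∉ R}.card + {p ∈ t | p.1 ∈ R}.card := by
  simpa only [Finset.card_eq_sum_ones] using sum_replaceOn s t R (fun _ => 1)

/-- The alternating path of `s` and `t` that starts in a row `u` used only by `s`. -/
theorem exists_alternating_block (s t : Finset (α × β)) (hs : IsMatching s) (ht : IsMatching t)
    (u : α) (hu : ∃ p ∈ s, p.1 = u) (hut : ∀ p ∈ t, p.1 ≠ u) :
    ∃ (R : Finset α) (C : Finset β), SplitsAt s R C ∧ SplitsAt t R C ∧ u ∈ R ∧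
      (∀ p ∈ t, p.2 ∈ C → ∃ q ∈ s, q.2 = p.2) ∧
      {p ∈ s | p.1 ∈ R}.card ≤ {p ∈ t | p.1 ∈ R}.card + 1 := by
  -- The path is peeled off at its start: remove the position of `s` in row `u` and the position of
  -- `t` in the same column, and continue from the row of the latter. The path ends when that column
  -- is not used by `t`, or that row not by `s`.
  induction hn : s.card generalizing s t u with
  | zero =>
    obtain ⟨p, hp, -⟩ := hu
    rw [Finset.card_eq_zero] at hn
    simp [hn] at hp
  | succ n ih =>
    obtain ⟨⟨u, c⟩, hp, rfl⟩ := hu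
    have hrow : ∀ q ∈ s, q.1 = u → q = (u, c) := fun q hq h => hs.eq_of_fst hq hp h
    have hcol : ∀ q ∈ s, q.2 = c → q = (u, c) := fun q hq h => hs.eq_of_snd hq hp h
    by_cases hc : ∃ q ∈ t, q.2 = c
    · obtain ⟨⟨u', c'⟩, hq, rfl⟩ := hc
      simp only at hcol hp hrow hut
      have hne : u' ≠ u := hut _ hq
      have hrow' : ∀ q ∈ t, q.1 = u' → q = (u', c') := fun q hq' h => ht.eq_of_fst hq' hq h
      have hcol' : ∀ q ∈ t, q.2 = c' → q = (u', c') := fun q hq' h => ht.eq_of_snd hq' hq h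
      by_cases hu' : ∃ q ∈ s, q.1 = u'
      · obtain ⟨R, C, h1, h2, h3, h4, h5⟩ := ih (s.erase (u, c')) (t.erase (u', c'))
          (hs.subset (Finset.erase_subset _ _)) (ht.subset (Finset.erase_subset _ _)) u'
          (by
            obtain ⟨q, hq1, hq2⟩ := hu'
            refine ⟨q, Finset.mem_erase.2 ⟨?_, hq1⟩, hq2⟩
            rintro rfl
            exact hne hq2.symm)
          (by
            intro q hq1 hq2
            rw [Finset.mem_erase] at hq1
            exact hq1.1 (hrow' q hq1.2 hq2))
          (by rw [Finset.card_erase_of_mem hp, hn]; rfl)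
        refine ⟨insert u R, insert c' C, ?_, ?_, by simp, ?_, ?_⟩
        · intro q hq1
          by_cases hqe : q = (u, c')
          · subst hqe; simp
          · have := h1 q (Finset.mem_erase.2 ⟨hqe, hq1⟩)
            have a1 : q.1 ≠ u := fun h => hqe (hrow q hq1 h)
            have a2 : q.2 ≠ c' := fun h => hqe (hcol q hq1 h)
            simp [a1, a2, this]
        · intro q hq1
          by_cases hqe : q = (u', c')
          · subst hqe; simp [h3]
          · have := h2 q (Finset.mem_erase.2 ⟨hqe, hq1⟩)
            have a1 : q.1 ≠ u := hut q hq1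
            have a2 : q.2 ≠ c' := fun h => hqe (hcol' q hq1 h)
            simp [a1, a2, this]
        · intro q hq1 hq2
          by_cases hqe : q = (u', c')
          · subst hqe; exact ⟨_, hp, rfl⟩
          · have a2 : q.2 ≠ c' := fun h => hqe (hcol' q hq1 h)
            obtain ⟨q', hq', h'⟩ := h4 q (Finset.mem_erase.2 ⟨hqe, hq1⟩)
              (by simpa [a2] using hq2)
            exact ⟨q', Finset.mem_of_mem_erase hq', h'⟩
        · have e1 : {p ∈ s | p.1 ∈ insert u R} =
              insert (u, c') {p ∈ s.erase (u, c') | p.1 ∈ R} := by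
            ext q
            simp only [Finset.mem_filter, Finset.mem_insert, Finset.mem_erase]
            by_cases hqe : q = (u, c')
            · subst hqe; simp [hp]
            · have a1 : q ∈ s → q.1 ≠ u := fun hq h => hqe (hrow q hq h)
              grind
          have e2 : insert (u', c') {p ∈ t.erase (u', c') | p.1 ∈ R} ⊆
              {p ∈ t | p.1 ∈ insert u R} := by
            intro q
            simp only [Finset.mem_filter, Finset.mem_insert, Finset.mem_erase]
            grind
          have e3 := Finset.card_le_card e2
          rw [Finset.card_insert_of_notMem (by simp)] at e3
          rw [e1, Finset.card_insert_of_notMem (by simp)]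
          omega
      · push Not at hu'
        refine ⟨{u, u'}, {c'}, ?_, ?_, by simp, ?_, ?_⟩
        · intro q hq1
          have := hu' q hq1
          simp only [Finset.mem_insert, Finset.mem_singleton, this, or_false]
          exact ⟨fun h => by rw [hrow q hq1 h], fun h => by rw [hcol q hq1 h]⟩
        · intro q hq1
          have := hut q hq1
          simp only [Finset.mem_insert, Finset.mem_singleton, this, false_or]
          exact ⟨fun h => by rw [hrow' q hq1 h], fun h => by rw [hcol' q hq1 h]⟩
        · intro q hq1 hq2
          exact ⟨_, hp, (Finset.mem_singleton.1 hq2).symm⟩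
        · have : {p ∈ s | p.1 ∈ ({u, u'} : Finset α)} ⊆ {(u, c')} := by
            intro q hq1
            simp only [Finset.mem_filter, Finset.mem_insert, Finset.mem_singleton] at hq1 ⊢
            rcases hq1 with ⟨h, h' | h'⟩
            · exact hrow q h h'
            · exact absurd h' (hu' q h)
          have := Finset.card_le_card this
          rw [Finset.card_singleton] at this
          omega
    · push Not at hc
      refine ⟨{u}, {c}, ?_, ?_, by simp, ?_, ?_⟩
      · intro q hq1
        simp only [Finset.mem_singleton]
        exact ⟨fun h => by rw [hrow q hq1 h], fun h => by rw [hcol q hq1 h]⟩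
      · intro q hq1
        have h1 := hut q hq1
        have h2 := hc q hq1
        simp_all
      · intro q hq1 hq2
        exact absurd (Finset.mem_singleton.1 hq2) (hc q hq1)
      · have : {p ∈ s | p.1 ∈ ({u} : Finset α)} ⊆ {(u, c)} := by
          intro q hq1
          simp only [Finset.mem_filter, Finset.mem_singleton] at hq1 ⊢
          exact hrow q hq1.1 hq1.2
        have := Finset.card_le_card this
        rw [Finset.card_singleton] at this
        omega

/-- Inside the block, `t` is injected into the columns used by `s`. -/
theorem card_filter_le_of_cols {s t : Finset (α × β)} (ht : IsMatching t) {R : Finset α}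
    {C : Finset β} (hsK : SplitsAt s R C) (htK : SplitsAt t R C)
    (h : ∀ p ∈ t, p.2 ∈ C → ∃ q ∈ s, q.2 = p.2) :
    {p ∈ t | p.1 ∈ R}.card ≤ {p ∈ s | p.1 ∈ R}.card := by
  rw [← Finset.card_image_of_injOn (s := {p ∈ t | p.1 ∈ R}) (f := Prod.snd)
    (ht.cols.mono (by intro p hp; exact Finset.mem_coe.2 (Finset.mem_filter.1 hp).1))]
  refine le_trans (Finset.card_le_card ?_) (Finset.card_image_le (f := Prod.snd))
  intro c hc
  obtain ⟨p, hp, rfl⟩ := Finset.mem_image.1 hc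
  obtain ⟨hp, hR⟩ := Finset.mem_filter.1 hp
  have hC := (htK p hp).1 hR
  obtain ⟨q, hq, hqc⟩ := h p hp hC
  exact Finset.mem_image.2 ⟨q, Finset.mem_filter.2 ⟨hq, (hsK q hq).2 (hqc ▸ hC)⟩, hqc⟩

/-- If `s` is larger than `t`, then some block contains exactly one more position of `s`. -/
theorem exists_block_of_card_lt (s t : Finset (α × β)) (hs : IsMatching s) (ht : IsMatching t)
    (h : t.card < s.card) :
    ∃ (R : Finset α) (C : Finset β), SplitsAt s R C ∧ SplitsAt t R C ∧
      {p ∈ s | p.1 ∈ R}.card = {p ∈ t | p.1 ∈ R}.card + 1 := by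
  induction hn : s.card using Nat.strong_induction_on generalizing s t with
  | _ n ih =>
    obtain ⟨p, hp, hpt⟩ := exists_row_of_card_lt hs h
    obtain ⟨R, C, h1, h2, h3, h4, h5⟩ := exists_alternating_block s t hs ht p.1 ⟨p, hp, rfl⟩ hpt
    have h6 := card_filter_le_of_cols ht h1 h2 h4
    rcases h6.lt_or_eq with h7 | h7
    · exact ⟨R, C, h1, h2, by omega⟩
    have ks := Finset.card_filter_add_card_filter_not (s := s) (fun p => p.1 ∈ R)
    have kt := Finset.card_filter_add_card_filter_not (s := t) (fun p => p.1 ∈ R)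
    have hpos : 0 < {p ∈ s | p.1 ∈ R}.card :=
      Finset.card_pos.2 ⟨p, Finset.mem_filter.2 ⟨hp, h3⟩⟩
    -- A balanced path is discarded; outside it, `s` is still larger than `t`.
    obtain ⟨R', C', k1, k2, k3⟩ := ih _ (by omega) {p ∈ s | p.1 ∉ R} {p ∈ t | p.1 ∉ R}
      (hs.subset (Finset.filter_subset _ _)) (ht.subset (Finset.filter_subset _ _))
      (by omega) rfl
    refine ⟨R' \ R, C' \ C, ?_, ?_, ?_⟩
    · intro q hq
      have := h1 q hq
      have := k1 q
      simp only [Finset.mem_filter, Finset.mem_sdiff] at *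
      tauto
    · intro q hq
      have := h2 q hq
      have := k2 q
      simp only [Finset.mem_filter, Finset.mem_sdiff] at *
      tauto
    · rw [Finset.filter_filter, Finset.filter_filter] at k3
      simpa only [Finset.mem_sdiff, and_comm] using k3

theorem IsMatching.swap {s : Finset (α × β)} (hs : IsMatching s) :
    IsMatching (s.image Prod.swap) := by
  constructor
  · intro p hp q hq h
    simp only [Finset.coe_image, Set.mem_image, Finset.mem_coe] at hp hq
    obtain ⟨p, hp, rfl⟩ := hp
    obtain ⟨q, hq, rfl⟩ := hq
    rw [hs.eq_of_snd hp hq h]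
  · intro p hp q hq h
    simp only [Finset.coe_image, Set.mem_image, Finset.mem_coe] at hp hq
    obtain ⟨p, hp, rfl⟩ := hp
    obtain ⟨q, hq, rfl⟩ := hq
    rw [hs.eq_of_fst hp hq h]

/-- If one matching uses all rows of `P` and another one uses all columns of `Q`, then some
matching contained in their union does both. -/
theorem exists_matching_covering (G : Finset (α × β)) (P : Finset α) (Q : Finset β)
    (s t : Finset (α × β)) (hs : IsMatching s) (ht : IsMatching t) (hsG : s ⊆ G) (htG : t ⊆ G)
    (hP : ∀ a ∈ P, ∃ p ∈ s, p.1 = a) (hQ : ∀ b ∈ Q, ∃ p ∈ t, p.2 = b) :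
    ∃ M ⊆ G, IsMatching M ∧ (∀ a ∈ P, ∃ p ∈ M, p.1 = a) ∧ ∀ b ∈ Q, ∃ p ∈ M, p.2 = b := by
  classical
  induction hn : (Q \ s.image Prod.snd).card using Nat.strong_induction_on generalizing s with
  | _ n ih =>
    by_cases hall : ∀ b ∈ Q, ∃ p ∈ s, p.2 = b
    · exact ⟨s, hsG, hs, hP, hall⟩
    push Not at hall
    obtain ⟨b, hbQ, hb⟩ := hall
    -- After transposition this is the alternating path from a column `b` that `s` misses. Passing
    -- from `s` to `t` along it gains `b` and loses no row that `s` used and no column of `Q`. This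
    -- is the Mendelsohn–Dulmage argument.
    obtain ⟨C, R, h1, h2, h3, h4, -⟩ := exists_alternating_block (t.image Prod.swap)
      (s.image Prod.swap) ht.swap hs.swap b
      (by
        obtain ⟨p, hp, hpb⟩ := hQ b hbQ
        exact ⟨p.swap, Finset.mem_image_of_mem _ hp, hpb⟩)
      (by
        intro p hp
        obtain ⟨q, hq, rfl⟩ := Finset.mem_image.1 hp
        exact hb q hq)
    have k1 : SplitsAt t R C := fun p hp => (h1 p.swap (Finset.mem_image_of_mem _ hp)).symm
    have k2 : SplitsAt s R C := fun p hp => (h2 p.swap (Finset.mem_image_of_mem _ hp)).symm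
    have k4 : ∀ p ∈ s, p.1 ∈ R → ∃ q ∈ t, q.1 = p.1 := by
      intro p hp hpR
      obtain ⟨q, hq, h⟩ := h4 p.swap (Finset.mem_image_of_mem _ hp) hpR
      obtain ⟨q, hq', rfl⟩ := Finset.mem_image.1 hq
      exact ⟨q, hq', h⟩
    refine ih _ ?_ (replaceOn s t R) (hs.replaceOn ht k2 k1) ?_ ?_ rfl
    · rw [← hn]
      apply Finset.card_lt_card
      rw [Finset.ssubset_iff_of_subset]
      · refine ⟨b, ?_, ?_⟩
        · simp only [Finset.mem_sdiff, Finset.mem_image, not_exists, not_and]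
          exact ⟨hbQ, hb⟩
        · obtain ⟨p, hp, hpb⟩ := hQ b hbQ
          simp only [Finset.mem_sdiff, Finset.mem_image, not_and, not_not]
          intro _
          refine ⟨p, ?_, hpb⟩
          exact Finset.mem_union_right _ (Finset.mem_filter.2 ⟨hp, (k1 p hp).2 (hpb ▸ h3)⟩)
      · intro c hc
        simp only [Finset.mem_sdiff, Finset.mem_image, not_exists, not_and] at hc ⊢
        refine ⟨hc.1, fun p hp hpc => ?_⟩
        by_cases hpR : p.1 ∈ R
        · obtain ⟨q, hq, hqc⟩ := hQ c hc.1
          refine hc.2 q (Finset.mem_union_right _ (Finset.mem_filter.2 ⟨hq, ?_⟩)) hqc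
          rw [k1 q hq, hqc, ← hpc, ← k2 p hp]
          exact hpR
        · exact hc.2 p (Finset.mem_union_left _ (Finset.mem_filter.2 ⟨hp, hpR⟩)) hpc
    · exact Finset.union_subset ((Finset.filter_subset _ _).trans hsG)
        ((Finset.filter_subset _ _).trans htG)
    · intro a ha
      obtain ⟨p, hp, rfl⟩ := hP a ha
      by_cases hpR : p.1 ∈ R
      · obtain ⟨q, hq, h⟩ := k4 p hp hpR
        exact ⟨q, Finset.mem_union_right _ (Finset.mem_filter.2 ⟨hq, h ▸ hpR⟩), h⟩
      · exact ⟨p, Finset.mem_union_left _ (Finset.mem_filter.2 ⟨hp, hpR⟩), rfl⟩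

end Matchings

/-! ### Linear programming duality for weighted matchings -/

section Duality

open Filter Topology

variable {α β : Type*} [Fintype α] [Fintype β]

/-- `y` and `z` are nonnegative potentials that dominate the weights `w`. -/
structure IsWeightCover (w : α → β → ℝ) (y : α → ℝ) (z : β → ℝ) : Prop where
  row_nonneg : ∀ i, 0 ≤ y i
  col_nonneg : ∀ b, 0 ≤ z b
  le_add : ∀ i b, w i b ≤ y i + z b

/-- Hall's condition holds for the rows of positive potential in the graph of tight positions: if a
set `X` of such rows had fewer than `|X|` tight neighbours, lowering `y` by a small ε on `X` and
raising `z` by ε on the neighbours would give a cheaper cover. -/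
theorem IsWeightCover.exists_tight_matching {w : α → β → ℝ} {y : α → ℝ} {z : β → ℝ}
    (h : IsWeightCover w y z)
    (hmin : ∀ y' z', IsWeightCover w y' z' → ∑ i, y i + ∑ b, z b ≤ ∑ i, y' i + ∑ b, z' b) :
    ∃ s : Finset (α × β), IsMatching s ∧ (∀ p ∈ s, w p.1 p.2 = y p.1 + z p.2) ∧
      ∀ i, 0 < y i → ∃ p ∈ s, p.1 = i := by
  classical
  let N : {i // 0 < y i} → Finset β := fun i => {b | w i b = y i + z b}
  have hall : ∀ X : Finset {i // 0 < y i}, X.card ≤ (X.biUnion N).card := by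
    intro X
    by_contra! hX
    have h1 : ∀ᶠ ε : ℝ in 𝓝[>] 0, ∀ i : {i // 0 < y i}, ε < y i := by
      rw [eventually_all]
      exact fun i => eventually_nhdsWithin_of_eventually_nhds (eventually_lt_nhds i.2)
    have h2 : ∀ᶠ ε : ℝ in 𝓝[>] 0, ∀ i b, w i b ≠ y i + z b → ε < y i + z b - w i b := by
      rw [eventually_all]
      intro i
      rw [eventually_all]
      intro b
      by_cases hb : w i b = y i + z b
      · simp [hb]
      · have : 0 < y i + z b - w i b := by
          have := lt_of_le_of_ne (h.le_add i b) hb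
          linarith
        filter_upwards [eventually_nhdsWithin_of_eventually_nhds (eventually_lt_nhds this)]
          with ε hε _ using hε
    obtain ⟨ε, ⟨hε1, hε2⟩, hε0⟩ := ((h1.and h2).and self_mem_nhdsWithin).exists
    have hε0 : 0 < ε := hε0
    let X' : Finset α := X.map (Function.Embedding.subtype _)
    have hX' : ∀ i, i ∈ X' ↔ ∃ hi : 0 < y i, ⟨i, hi⟩ ∈ X := by
      intro i
      simp [X']
    have hcard : X'.card = X.card := Finset.card_map _
    have := hmin (fun i => y i - if i ∈ X' then ε else 0)
      (fun b => z b + if b ∈ X.biUnion N then ε else 0)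
      ⟨fun i => by
        by_cases hi : i ∈ X'
        · obtain ⟨hi', -⟩ := (hX' i).1 hi
          have := hε1 ⟨i, hi'⟩
          simp only [hi, if_true]
          linarith
        · simpa [hi] using h.row_nonneg i,
      fun b => by
        have := h.col_nonneg b
        split_ifs <;> linarith,
      fun i b => by
        have h0 := h.le_add i b
        by_cases hi : i ∈ X'
        · by_cases hb : b ∈ X.biUnion N
          · simp only [hi, hb, if_true]
            linarith
          · obtain ⟨hi', hiX⟩ := (hX' i).1 hi
            have hne : w i b ≠ y i + z b := by
              intro he
              exact hb (Finset.mem_biUnion.2 ⟨_, hiX, by simpa [N] using he⟩)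
            have := hε2 i b hne
            simp only [hi, hb, if_true, if_false]
            linarith
        · simp only [hi, if_false]
          split_ifs <;> linarith⟩
    rw [Finset.sum_sub_distrib, Finset.sum_add_distrib] at this
    simp only [Finset.sum_ite_mem, Finset.univ_inter, Finset.sum_const, nsmul_eq_mul, hcard]
      at this
    have hX2 : ((X.biUnion N).card : ℝ) < X.card := by exact_mod_cast hX
    nlinarith
  obtain ⟨f, hf, hfN⟩ := (Finset.all_card_le_biUnion_card_iff_exists_injective N).1 hall
  refine ⟨Finset.univ.image (fun i : {i // 0 < y i} => (i.1, f i)), ⟨?_, ?_⟩, ?_, ?_⟩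
  · intro p hp q hq hpq
    simp only [Finset.coe_image, Finset.coe_univ, Set.image_univ, Set.mem_range] at hp hq
    obtain ⟨i, rfl⟩ := hp
    obtain ⟨j, rfl⟩ := hq
    rw [Subtype.ext hpq]
  · intro p hp q hq hpq
    simp only [Finset.coe_image, Finset.coe_univ, Set.image_univ, Set.mem_range] at hp hq
    obtain ⟨i, rfl⟩ := hp
    obtain ⟨j, rfl⟩ := hq
    rw [hf hpq]
  · intro p hp
    obtain ⟨i, -, rfl⟩ := Finset.mem_image.1 hp
    simpa [N] using hfN i
  · intro i hi
    exact ⟨(i, f ⟨i, hi⟩), Finset.mem_image.2 ⟨⟨i, hi⟩, Finset.mem_univ _, rfl⟩, rfl⟩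

/-- Compactness: covers that are no more expensive than a fixed constant one lie in a box. -/
theorem exists_min_weightCover (w : α → β → ℝ) :
    ∃ y z, IsWeightCover w y z ∧
      ∀ y' z', IsWeightCover w y' z' → ∑ i, y i + ∑ b, z b ≤ ∑ i, y' i + ∑ b, z' b := by
  classical
  let W : ℝ := ∑ i, ∑ b, |w i b|
  have hW0 : 0 ≤ W := Finset.sum_nonneg fun i _ => Finset.sum_nonneg fun b _ => abs_nonneg _
  have hW : ∀ i b, w i b ≤ W := fun i b =>
    (le_abs_self _).trans <| (Finset.single_le_sum (f := fun b => |w i b|)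
      (fun b _ => abs_nonneg _) (Finset.mem_univ b)).trans
      (Finset.single_le_sum (f := fun i => ∑ b, |w i b|)
        (fun i _ => Finset.sum_nonneg fun b _ => abs_nonneg _) (Finset.mem_univ i))
  let S : ℝ := ∑ _i : α, W
  let K : Set ((α → ℝ) × (β → ℝ)) :=
    Set.Icc 0 (fun _ => S, fun _ => S) ∩ {q | ∀ i b, w i b ≤ q.1 i + q.2 b}
  have hclosed : IsClosed {q : (α → ℝ) × (β → ℝ) | ∀ i b, w i b ≤ q.1 i + q.2 b} := by
    simp only [Set.ofPred_forall]
    refine isClosed_iInter fun i => isClosed_iInter fun b => isClosed_le (by fun_prop) ?_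
    fun_prop
  have hK : IsCompact K := isCompact_Icc.inter_right hclosed
  have hmem : ∀ y z, IsWeightCover w y z → ∑ i, y i + ∑ b, z b ≤ S → (y, z) ∈ K := by
    intro y z h hle
    have hy := Finset.sum_nonneg (s := Finset.univ) fun i _ => h.row_nonneg i
    have hz := Finset.sum_nonneg (s := Finset.univ) fun i _ => h.col_nonneg i
    refine ⟨⟨⟨h.row_nonneg, h.col_nonneg⟩, ⟨fun i => ?_, fun b => ?_⟩⟩, h.le_add⟩
    · have := Finset.single_le_sum (fun i _ => h.row_nonneg i) (Finset.mem_univ i)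
      change y i ≤ S
      linarith
    · have := Finset.single_le_sum (fun i _ => h.col_nonneg i) (Finset.mem_univ b)
      change z b ≤ S
      linarith
  have h0 : IsWeightCover w (fun _ => W) (fun _ => 0) :=
    ⟨fun _ => hW0, fun _ => le_rfl, fun i b => by simpa using hW i b⟩
  have hS0 : ∑ _i : α, W + ∑ _b : β, (0 : ℝ) ≤ S := by simp [S]
  obtain ⟨⟨y, z⟩, hyz, hmin⟩ := hK.exists_isMinOn ⟨_, hmem _ _ h0 hS0⟩
    (f := fun q => ∑ i, q.1 i + ∑ b, q.2 b) (by fun_prop)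
  refine ⟨y, z, ⟨hyz.1.1.1, hyz.1.1.2, hyz.2⟩, fun y' z' h' => ?_⟩
  by_cases hle : ∑ i, y' i + ∑ b, z' b ≤ S
  · exact hmin (hmem y' z' h' hle)
  · have := hmin (hmem _ _ h0 hS0)
    simp only [Set.mem_ofPred_eq] at this
    linarith

/-- **Egerváry's theorem**: the maximal weight of a matching is the minimal total weight of a
cover. -/
theorem exists_weightCover_eq_matching (w : α → β → ℝ) :
    ∃ (y : α → ℝ) (z : β → ℝ) (M : Finset (α × β)), IsWeightCover w y z ∧ IsMatching M ∧
      ∑ i, y i + ∑ b, z b = ∑ p ∈ M, w p.1 p.2 := by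
  classical
  obtain ⟨y, z, h, hmin⟩ := exists_min_weightCover w
  obtain ⟨s, hs, hsT, hsP⟩ := h.exists_tight_matching hmin
  have h' : IsWeightCover (fun b i => w i b) z y :=
    ⟨h.col_nonneg, h.row_nonneg, fun b i => by linarith [h.le_add i b]⟩
  obtain ⟨t, ht, htT, htQ⟩ := h'.exists_tight_matching fun z' y' hzy => by
    have := hmin y' z' ⟨hzy.col_nonneg, hzy.row_nonneg, fun i b => by
      linarith [hzy.le_add b i]⟩
    linarith
  -- A matching of tight positions that meets every row and every column of positive potential has
  -- exactly the total weight of the cover.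
  obtain ⟨M, hMG, hM, hMP, hMQ⟩ := exists_matching_covering
    ({p | w p.1 p.2 = y p.1 + z p.2} : Finset (α × β)) {i | 0 < y i} {b | 0 < z b}
    s (t.image Prod.swap) hs ht.swap
    (fun p hp => by simpa using hsT p hp)
    (fun p hp => by
      obtain ⟨q, hq, rfl⟩ := Finset.mem_image.1 hp
      have := htT q hq
      simp only [Finset.mem_filter, Finset.mem_univ, true_and, Prod.fst_swap, Prod.snd_swap]
      linarith)
    (fun i hi => hsP i (by simpa using hi))
    (fun b hb => by
      obtain ⟨q, hq, hqb⟩ := htQ b (by simpa using hb)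
      exact ⟨q.swap, Finset.mem_image_of_mem _ hq, hqb⟩)
  refine ⟨y, z, M, h, hM, ?_⟩
  have e1 : ∑ p ∈ M, w p.1 p.2 = ∑ p ∈ M, y p.1 + ∑ p ∈ M, z p.2 := by
    rw [← Finset.sum_add_distrib]
    refine Finset.sum_congr rfl fun p hp => ?_
    simpa using hMG hp
  have e2 : ∑ p ∈ M, y p.1 = ∑ i, y i := by
    rw [← Finset.sum_image (f := y) (g := Prod.fst) hM.rows]
    refine Finset.sum_subset (Finset.subset_univ _) fun i _ hi => ?_
    by_contra hne
    obtain ⟨p, hp, hpi⟩ := hMP i (by simpa using lt_of_le_of_ne (h.row_nonneg i) (Ne.symm hne))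
    exact hi (Finset.mem_image.2 ⟨p, hp, hpi⟩)
  have e3 : ∑ p ∈ M, z p.2 = ∑ b, z b := by
    rw [← Finset.sum_image (f := z) (g := Prod.snd) hM.cols]
    refine Finset.sum_subset (Finset.subset_univ _) fun i _ hi => ?_
    by_contra hne
    obtain ⟨p, hp, hpi⟩ := hMQ i (by simpa using lt_of_le_of_ne (h.col_nonneg i) (Ne.symm hne))
    exact hi (Finset.mem_image.2 ⟨p, hp, hpi⟩)
  rw [e1, e2, e3]

end Duality

/-! ### Optimal assignments of varying size: convexity and nested rows -/

section Optimal

variable {m n : ℕ} {A : Fin m → Fin n → ℝ} {Z : Finset (Fin m × Fin n)} {j k : ℕ}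
  {s t : Finset (Fin m × Fin n)}

theorem IsAssignment.isMatching (h : IsAssignment k s) : IsMatching s := ⟨h.rows, h.cols⟩

theorem IsMatching.isAssignment (h : IsMatching s) (hk : s.card = k) : IsAssignment k s :=
  ⟨hk, h.rows, h.cols⟩

theorem IsAssignment.le_min (h : IsAssignment k s) : k ≤ min m n := by
  rw [← h.card_eq, le_min_iff]
  constructor
  · rw [← Finset.card_image_of_injOn h.rows]
    simpa using Finset.card_le_univ (s.image Prod.fst)
  · rw [← Finset.card_image_of_injOn h.cols]
    simpa using Finset.card_le_univ (s.image Prod.snd)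

theorem IsAssignment.erase (h : IsAssignment (k + 1) s) {p : Fin m × Fin n} (hp : p ∈ s) :
    IsAssignment k (s.erase p) :=
  (h.isMatching.subset (Finset.erase_subset _ _)).isAssignment
    (by rw [Finset.card_erase_of_mem hp, h.card_eq]; rfl)

theorem IsAssignment.exists_subset (h : IsAssignment k s) (hj : j ≤ k) :
    ∃ t ⊆ s, IsAssignment j t := by
  obtain ⟨t, hts, ht⟩ := Finset.exists_subset_card_eq (h.card_eq.symm ▸ hj)
  exact ⟨t, hts, (h.isMatching.subset hts).isAssignment ht⟩

theorem exists_isAssignment (hk : k ≤ min m n) :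
    ∃ s : Finset (Fin m × Fin n), IsAssignment k s := by
  have h1 : k ≤ m := hk.trans (min_le_left _ _)
  have h2 : k ≤ n := hk.trans (min_le_right _ _)
  refine ⟨Finset.univ.image fun i : Fin k => (Fin.castLE h1 i, Fin.castLE h2 i), ?_, ?_, ?_⟩
  · rw [Finset.card_image_of_injective _ fun a b h => ?_]
    · simp
    · simpa using congrArg Prod.fst h
  · intro p hp q hq h
    simp only [Finset.coe_image, Finset.coe_univ, Set.image_univ, Set.mem_range] at hp hq
    obtain ⟨a, rfl⟩ := hp
    obtain ⟨b, rfl⟩ := hq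
    have : a = b := by simpa using h
    rw [this]
  · intro p hp q hq h
    simp only [Finset.coe_image, Finset.coe_univ, Set.image_univ, Set.mem_range] at hp hq
    obtain ⟨a, rfl⟩ := hp
    obtain ⟨b, rfl⟩ := hq
    have : a = b := by simpa using h
    rw [this]

theorem exists_isOptimal (A : Fin m → Fin n → ℝ) (hk : k ≤ min m n) :
    ∃ s, IsOptimal A k s := by
  classical
  obtain ⟨s, hs⟩ := exists_isAssignment hk
  obtain ⟨t, ht, hmin⟩ := Finset.exists_min_image
    ({s | IsAssignment k s} : Finset (Finset (Fin m × Fin n))) (cost A) ⟨s, by simpa using hs⟩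
  exact ⟨t, by simpa using ht, fun u hu => hmin u (by simpa using hu)⟩

open Classical in
/-- The minimal cost of a `k`-assignment. -/
noncomputable def optValue (A : Fin m → Fin n → ℝ) (k : ℕ) : ℝ :=
  -- The default 0 is taken only for `k > min m n`.
  if h : ∃ s, IsOptimal A k s then cost A h.choose else 0

theorem IsOptimal.cost_eq (h : IsOptimal A k s) : cost A s = optValue A k := by
  have hex : ∃ s, IsOptimal A k s := ⟨s, h⟩
  rw [optValue, dif_pos hex]
  exact le_antisymm (h.2 _ hex.choose_spec.1) (hex.choose_spec.2 _ h.1)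

theorem IsAssignment.optValue_le (h : IsAssignment k s) : optValue A k ≤ cost A s := by
  obtain ⟨t, ht⟩ := exists_isOptimal A h.le_min
  rw [← ht.cost_eq]
  exact ht.2 s h

theorem IsAssignment.isOptimal (h : IsAssignment k s) (hc : cost A s ≤ optValue A k) :
    IsOptimal A k s :=
  ⟨h, fun _ ht => hc.trans ht.optValue_le⟩

theorem cost_replaceOn_add (A : Fin m → Fin n → ℝ) (s t : Finset (Fin m × Fin n))
    (R : Finset (Fin m)) :
    cost A (replaceOn s t R) + cost A (replaceOn t s R) = cost A s + cost A t := by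
  simp only [cost, sum_replaceOn]
  have h1 := Finset.sum_filter_add_sum_filter_not s (fun p => p.1 ∈ R) fun p => A p.1 p.2
  have h2 := Finset.sum_filter_add_sum_filter_not t (fun p => p.1 ∈ R) fun p => A p.1 p.2
  linarith

/-- A matrix that vanishes exactly on `Z`, and in which distinct sets of positions outside `Z` have
distinct costs. -/
structure IsGeneric (Z : Finset (Fin m × Fin n)) (A : Fin m → Fin n → ℝ) : Prop where
  zero : ∀ p ∈ Z, A p.1 p.2 = 0
  pos : ∀ p ∉ Z, 0 < A p.1 p.2
  cost_inj : ∀ s t : Finset (Fin m × Fin n), Disjoint s Z → Disjoint t Z →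
    cost A s = cost A t → s = t

theorem IsGeneric.nonneg (hA : IsGeneric Z A) (p : Fin m × Fin n) : 0 ≤ A p.1 p.2 := by
  by_cases hp : p ∈ Z
  · exact (hA.zero p hp).ge
  · exact (hA.pos p hp).le

theorem IsGeneric.cost_sdiff (hA : IsGeneric Z A) (s : Finset (Fin m × Fin n)) :
    cost A (s \ Z) = cost A s := by
  refine Finset.sum_subset Finset.sdiff_subset fun p hp hp' => hA.zero p ?_
  by_contra h
  exact hp' (Finset.mem_sdiff.2 ⟨hp, h⟩)

/-- Equal cost forces equal sets of nonzero positions, so optimal assignments can differ only in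
zeros. -/
theorem IsGeneric.mem_of_isOptimal (hA : IsGeneric Z A) (hs : IsOptimal A k s)
    (ht : IsOptimal A k t) {p : Fin m × Fin n} (hp : p ∈ s) (hpZ : p ∉ Z) : p ∈ t := by
  have : s \ Z = t \ Z := hA.cost_inj _ _ Finset.sdiff_disjoint Finset.sdiff_disjoint
    (by rw [hA.cost_sdiff, hA.cost_sdiff, hs.cost_eq, ht.cost_eq])
  have : p ∈ t \ Z := this ▸ Finset.mem_sdiff.2 ⟨hp, hpZ⟩
  exact (Finset.mem_sdiff.1 this).1

theorem cost_erase {p : Fin m × Fin n} (hp : p ∈ s) :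
    cost A (s.erase p) + A p.1 p.2 = cost A s :=
  Finset.sum_erase_add (f := fun p => A p.1 p.2) s hp

theorem IsGeneric.optValue_le_succ (hA : IsGeneric Z A) (hk : k + 1 ≤ min m n) :
    optValue A k ≤ optValue A (k + 1) := by
  obtain ⟨s, hs⟩ := exists_isOptimal A hk
  obtain ⟨p, hp⟩ : s.Nonempty := by
    rw [← Finset.card_pos, hs.1.card_eq]
    omega
  have h1 := (hs.1.erase hp).optValue_le (A := A)
  have h2 := cost_erase (A := A) hp
  have h3 := hA.nonneg p
  rw [hs.cost_eq] at h2
  linarith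

theorem IsGeneric.optValue_lt_succ (hA : IsGeneric Z A) (hk : k + 1 ≤ min m n)
    (hZ : ∀ s, IsAssignment (k + 1) s → ¬ s ⊆ Z) :
    optValue A k < optValue A (k + 1) := by
  obtain ⟨s, hs⟩ := exists_isOptimal A hk
  obtain ⟨p, hp, hpZ⟩ := Finset.not_subset.1 (hZ s hs.1)
  have h1 := (hs.1.erase hp).optValue_le (A := A)
  have h2 := cost_erase (A := A) hp
  have h3 := hA.pos p hpZ
  rw [hs.cost_eq] at h2
  linarith

theorem not_subset_of_le {Z : Finset (Fin m × Fin n)} (hjk : j ≤ k)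
    (hZ : ∀ s, IsAssignment j s → ¬ s ⊆ Z) (s) (hs : IsAssignment k s) : ¬ s ⊆ Z := by
  intro h
  obtain ⟨t, hts, ht⟩ := hs.exists_subset hjk
  exact hZ t ht (hts.trans h)

/-- Moving one unit of size from the larger to the smaller of two assignments. -/
theorem exists_balanced (hs : IsAssignment (j + 2) s) (ht : IsAssignment j t) :
    ∃ R : Finset (Fin m), IsAssignment (j + 1) (replaceOn s t R) ∧
      IsAssignment (j + 1) (replaceOn t s R) := by
  obtain ⟨R, C, h1, h2, h3⟩ := exists_block_of_card_lt s t hs.isMatching ht.isMatching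
    (by rw [hs.card_eq, ht.card_eq]; omega)
  have ks := Finset.card_filter_add_card_filter_not (s := s) (fun p => p.1 ∈ R)
  have kt := Finset.card_filter_add_card_filter_not (s := t) (fun p => p.1 ∈ R)
  rw [hs.card_eq] at ks
  rw [ht.card_eq] at kt
  refine ⟨R, (hs.isMatching.replaceOn ht.isMatching h1 h2).isAssignment ?_,
    (ht.isMatching.replaceOn hs.isMatching h2 h1).isAssignment ?_⟩
  · rw [card_replaceOn]; omega
  · rw [card_replaceOn]; omega

theorem optValue_convex (A : Fin m → Fin n → ℝ) (hj : j + 2 ≤ min m n) :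
    optValue A (j + 1) - optValue A j ≤ optValue A (j + 2) - optValue A (j + 1) := by
  obtain ⟨s, hs⟩ := exists_isOptimal A hj
  obtain ⟨t, ht⟩ := exists_isOptimal A (show j ≤ min m n by omega)
  obtain ⟨R, h1, h2⟩ := exists_balanced hs.1 ht.1
  have h := cost_replaceOn_add A s t R
  rw [hs.cost_eq, ht.cost_eq] at h
  have := h1.optValue_le (A := A)
  have := h2.optValue_le (A := A)
  linarith

/-- In case of equality both rebalanced assignments are optimal, so they share their nonzero
positions. Each nonzero position of `s` then lies in `t` too, and `s` costs no more than `t`,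
although the optimal value increases strictly from size `j + 1` to `j + 2`. -/
theorem IsGeneric.optValue_strict_convex (hA : IsGeneric Z A) (hj : j + 2 ≤ min m n)
    (hZ : ∀ s, IsAssignment (j + 2) s → ¬ s ⊆ Z) :
    optValue A (j + 1) - optValue A j < optValue A (j + 2) - optValue A (j + 1) := by
  refine lt_of_le_of_ne (optValue_convex A hj) fun heq => ?_
  obtain ⟨s, hs⟩ := exists_isOptimal A hj
  obtain ⟨t, ht⟩ := exists_isOptimal A (show j ≤ min m n by omega)
  obtain ⟨R, h1, h2⟩ := exists_balanced hs.1 ht.1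
  have h := cost_replaceOn_add A s t R
  rw [hs.cost_eq, ht.cost_eq] at h
  have k1 := h1.optValue_le (A := A)
  have k2 := h2.optValue_le (A := A)
  have o1 : IsOptimal A (j + 1) (RandomAssignment.replaceOn s t R) := h1.isOptimal (by linarith)
  have o2 : IsOptimal A (j + 1) (RandomAssignment.replaceOn t s R) := h2.isOptimal (by linarith)
  have hsub : s \ Z ⊆ t := by
    intro p hp
    obtain ⟨hp, hpZ⟩ := Finset.mem_sdiff.1 hp
    by_cases hR : p.1 ∈ R
    · have := hA.mem_of_isOptimal o2 o1 (p := p)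
        (Finset.mem_union_right _ (Finset.mem_filter.2 ⟨hp, hR⟩)) hpZ
      simpa [RandomAssignment.replaceOn, hR] using this
    · have := hA.mem_of_isOptimal o1 o2 (p := p)
        (Finset.mem_union_left _ (Finset.mem_filter.2 ⟨hp, hR⟩)) hpZ
      simpa [RandomAssignment.replaceOn, hR] using this
  have hle : cost A s ≤ cost A t := by
    rw [← hA.cost_sdiff s]
    exact Finset.sum_le_sum_of_subset_of_nonneg hsub fun p _ _ => hA.nonneg p
  rw [hs.cost_eq, ht.cost_eq] at hle
  have l1 := hA.optValue_le_succ (show j + 1 ≤ min m n by omega)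
  have l2 := hA.optValue_lt_succ (k := j + 1) hj hZ
  have : optValue A (j + 1 + 1) = optValue A (j + 2) := rfl
  linarith

/-- A convex sequence lies strictly above the line through two consecutive terms, elsewhere, if the
increments to both sides are different. -/
theorem lt_of_convex {v : ℕ → ℝ} {N : ℕ}
    (hv : ∀ l, l + 2 ≤ N → v (l + 1) - v l ≤ v (l + 2) - v (l + 1)) {j : ℕ} (hj : j + 1 ≤ N)
    (hlow : ∀ l, l + 1 = j → v j - v l < v (j + 1) - v j)
    (hhigh : j + 2 ≤ N → v (j + 1) - v j < v (j + 2) - v (j + 1)) {l : ℕ} (hl : l ≤ N)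
    (h1 : l ≠ j) (h2 : l ≠ j + 1) :
    v j - j * (v (j + 1) - v j) < v l - l * (v (j + 1) - v j) := by
  have mono : ∀ a d, a + d + 1 ≤ N → v (a + 1) - v a ≤ v (a + d + 1) - v (a + d) := by
    intro a d
    induction d with
    | zero => intro _; exact le_rfl
    | succ d ih => intro h; exact (ih (by omega)).trans (hv (a + d) (by omega))
  set c := v (j + 1) - v j with hc
  rcases lt_or_gt_of_ne h1 with hlt | hgt
  · have key : ∀ d a, a + d + 1 = j → v j - j * c < v a - a * c := by
      intro d
      induction d with
      | zero =>
        intro a ha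
        have := hlow a ha
        have e : (j : ℝ) = a + 1 := by exact_mod_cast ha.symm
        rw [e]
        linarith
      | succ d ih =>
        intro a ha
        have h3 := ih (a + 1) (by omega)
        have h4 := mono a (d + 1) (by omega)
        have h5 := hlow (a + (d + 1)) (by omega)
        have e : a + (d + 1) + 1 = j := by omega
        rw [e] at h4
        push_cast at h3
        linarith
    exact key (j - l - 1) l (by omega)
  · have key : ∀ d, j + d + 2 ≤ N → v j - j * c < v (j + d + 2) - (j + d + 2) * c := by
      intro d
      induction d with
      | zero =>
        intro h
        have := hhigh h
        push_cast
        simp only [add_zero]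
        linarith
      | succ d ih =>
        intro h
        have h3 := ih (by omega)
        have h4 := mono (j + 1) (d + 1) (by omega)
        have h5 := hhigh (by omega)
        rw [show j + 1 + (d + 1) + 1 = j + (d + 1) + 2 by omega,
          show j + 1 + (d + 1) = j + d + 2 by omega] at h4
        push_cast
        linarith
    obtain ⟨d, rfl⟩ : ∃ d, l = j + d + 2 := ⟨l - j - 2, by omega⟩
    have := key d hl
    push_cast
    exact this

open Classical in
/-- The rows that are used by every optimal `k`-assignment. -/
noncomputable def commonRows (A : Fin m → Fin n → ℝ) (k : ℕ) : Finset (Fin m) :=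
  {i | ∀ s, IsOptimal A k s → UsesRow s i}

theorem mem_commonRows {i : Fin m} :
    i ∈ commonRows A k ↔ ∀ s, IsOptimal A k s → UsesRow s i := by
  simp [commonRows]

theorem usesRow_iff {i : Fin m} : UsesRow s i ↔ ∃ p ∈ s, p.1 = i :=
  ⟨fun ⟨b, h⟩ => ⟨_, h, rfl⟩, by rintro ⟨p, hp, rfl⟩; exact ⟨p.2, hp⟩⟩

theorem IsGeneric.mem_commonRows_of_mem (hA : IsGeneric Z A) (hs : IsOptimal A k s)
    {p : Fin m × Fin n} (hp : p ∈ s) (hpZ : p ∉ Z) : p.1 ∈ commonRows A k :=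
  mem_commonRows.2 fun _ ht => ⟨p.2, hA.mem_of_isOptimal hs ht hp hpZ⟩

/-- If an optimal (j+1)-assignment `t` misses a common row `f`, exchange along the alternating path
from `f`. Either the sizes are kept, and an optimal j-assignment without `f` arises, or they become
j - 1 and j + 2, which contradicts strict convexity. -/
theorem IsGeneric.commonRows_subset_succ (hA : IsGeneric Z A) (hj : j + 1 ≤ min m n)
    (hZ : ∀ s, IsAssignment (j + 1) s → ¬ s ⊆ Z) :
    commonRows A j ⊆ commonRows A (j + 1) := by
  intro f hf
  rw [mem_commonRows] at hf ⊢
  intro t ht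
  by_contra hft
  obtain ⟨s, hs⟩ := exists_isOptimal A (show j ≤ min m n by omega)
  have hft' : ∀ p ∈ t, p.1 ≠ f := fun p hp h => hft (usesRow_iff.2 ⟨p, hp, h⟩)
  obtain ⟨R, C, h1, h2, h3, h4, h5⟩ := exists_alternating_block s t hs.1.isMatching ht.1.isMatching
    f (usesRow_iff.1 (hf s hs)) hft'
  have h6 := card_filter_le_of_cols ht.1.isMatching h1 h2 h4
  have ks := Finset.card_filter_add_card_filter_not (s := s) (fun p => p.1 ∈ R)
  have kt := Finset.card_filter_add_card_filter_not (s := t) (fun p => p.1 ∈ R)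
  rw [hs.1.card_eq] at ks
  rw [ht.1.card_eq] at kt
  have m1 := hs.1.isMatching.replaceOn ht.1.isMatching h1 h2
  have m2 := ht.1.isMatching.replaceOn hs.1.isMatching h2 h1
  have c1 := card_replaceOn s t R
  have c2 := card_replaceOn t s R
  have hcost := cost_replaceOn_add A s t R
  rw [hs.cost_eq, ht.cost_eq] at hcost
  rcases h6.lt_or_eq with h7 | h7
  · obtain ⟨i, rfl⟩ : ∃ i, j = i + 1 := ⟨j - 1, by omega⟩
    have a1 := m1.isAssignment (k := i) (by omega)
    have a2 := m2.isAssignment (k := i + 3) (by omega)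
    have b1 := a1.optValue_le (A := A)
    have b2 := a2.optValue_le (A := A)
    have d1 := hA.optValue_strict_convex (j := i) hj hZ
    have d2 := optValue_convex A (j := i + 1) a2.le_min
    simp only [add_assoc, Nat.reduceAdd] at *
    linarith
  · have a1 := m1.isAssignment (k := j) (by omega)
    have a2 := m2.isAssignment (k := j + 1) (by omega)
    have b2 := a2.optValue_le (A := A)
    obtain ⟨b, hb⟩ := hf _ (a1.isOptimal (by linarith))
    rcases Finset.mem_union.1 hb with hb | hb
    · exact (Finset.mem_filter.1 hb).2 h3
    · exact hft' _ (Finset.mem_filter.1 hb).1 rfl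

/-- Dual variables that certify the optimal values for `j` and `j + 1` at the same time. -/
structure IsPotential (A : Fin m → Fin n → ℝ) (j : ℕ) (c : ℝ) (y : Fin m → ℝ) (z : Fin n → ℝ) :
    Prop where
  pos : 0 < c
  row_nonneg : ∀ i, 0 ≤ y i
  col_nonneg : ∀ b, 0 ≤ z b
  le_add : ∀ i b, c ≤ A i b + y i + z b
  value : j * c - (∑ i, y i + ∑ b, z b) = optValue A j
  value_succ : (j + 1) * c - (∑ i, y i + ∑ b, z b) = optValue A (j + 1)
  row_pos : ∀ i ∈ commonRows A j, 0 < y i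

/-! ### Weak duality, complementary slackness and the existence of potentials -/

theorem sum_rows_le {y : Fin m → ℝ} (hy : ∀ i, 0 ≤ y i) (hs : IsMatching s) :
    ∑ p ∈ s, y p.1 ≤ ∑ i, y i := by
  rw [← Finset.sum_image (f := y) (g := Prod.fst) hs.rows]
  exact Finset.sum_le_sum_of_subset_of_nonneg (Finset.subset_univ _) fun i _ _ => hy i

theorem sum_rows_add_le {y : Fin m → ℝ} (hy : ∀ i, 0 ≤ y i) (hs : IsMatching s) {i : Fin m}
    (hi : ∀ p ∈ s, p.1 ≠ i) : ∑ p ∈ s, y p.1 + y i ≤ ∑ i, y i := by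
  rw [← Finset.sum_image (f := y) (g := Prod.fst) hs.rows, add_comm,
    ← Finset.sum_insert (by simpa using fun b h => hi (i, b) h rfl)]
  exact Finset.sum_le_sum_of_subset_of_nonneg (Finset.subset_univ _) fun i _ _ => hy i

theorem sum_cols_le {z : Fin n → ℝ} (hz : ∀ i, 0 ≤ z i) (hs : IsMatching s) :
    ∑ p ∈ s, z p.2 ≤ ∑ i, z i := by
  rw [← Finset.sum_image (f := z) (g := Prod.snd) hs.cols]
  exact Finset.sum_le_sum_of_subset_of_nonneg (Finset.subset_univ _) fun i _ _ => hz i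

theorem sum_cols_add_le {z : Fin n → ℝ} (hz : ∀ i, 0 ≤ z i) (hs : IsMatching s) {i : Fin n}
    (hi : ∀ p ∈ s, p.2 ≠ i) : ∑ p ∈ s, z p.2 + z i ≤ ∑ i, z i := by
  rw [← Finset.sum_image (f := z) (g := Prod.snd) hs.cols, add_comm,
    ← Finset.sum_insert (by simpa using fun b h => hi (b, i) h rfl)]
  exact Finset.sum_le_sum_of_subset_of_nonneg (Finset.subset_univ _) fun i _ _ => hz i

theorem cost_add_sum {c : ℝ} {y : Fin m → ℝ} {z : Fin n → ℝ} (hs : IsAssignment k s) :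
    ∑ p ∈ s, (A p.1 p.2 + y p.1 + z p.2 - c) =
      cost A s + ∑ p ∈ s, y p.1 + ∑ p ∈ s, z p.2 - k * c := by
  rw [Finset.sum_sub_distrib, Finset.sum_add_distrib, Finset.sum_add_distrib, Finset.sum_const,
    hs.card_eq, nsmul_eq_mul, cost]

theorem weak_duality {c : ℝ} {y : Fin m → ℝ} {z : Fin n → ℝ} (hy : ∀ i, 0 ≤ y i)
    (hz : ∀ i, 0 ≤ z i) (hle : ∀ i b, c ≤ A i b + y i + z b) (hs : IsAssignment k s) :
    k * c - (∑ i, y i + ∑ b, z b) ≤ cost A s := by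
  have h1 := cost_add_sum (A := A) (c := c) (y := y) (z := z) hs
  have h2 : 0 ≤ ∑ p ∈ s, (A p.1 p.2 + y p.1 + z p.2 - c) :=
    Finset.sum_nonneg fun p _ => by linarith [hle p.1 p.2]
  linarith [sum_rows_le hy hs.isMatching, sum_cols_le hz hs.isMatching]

theorem complementary_slackness {c : ℝ} {y : Fin m → ℝ} {z : Fin n → ℝ} (hy : ∀ i, 0 ≤ y i)
    (hz : ∀ i, 0 ≤ z i) (hle : ∀ i b, c ≤ A i b + y i + z b) (hs : IsAssignment k s)
    (hc : cost A s = k * c - (∑ i, y i + ∑ b, z b)) :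
    (∀ p ∈ s, A p.1 p.2 + y p.1 + z p.2 = c) ∧ (∀ i, 0 < y i → ∃ p ∈ s, p.1 = i) ∧
      ∀ b, 0 < z b → ∃ p ∈ s, p.2 = b := by
  have h1 := cost_add_sum (A := A) (c := c) (y := y) (z := z) hs
  have h0 : ∀ p ∈ s, 0 ≤ A p.1 p.2 + y p.1 + z p.2 - c := fun p _ => by
    linarith [hle p.1 p.2]
  have h2 : 0 ≤ ∑ p ∈ s, (A p.1 p.2 + y p.1 + z p.2 - c) := Finset.sum_nonneg h0
  have h3 := sum_rows_le hy hs.isMatching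
  have h4 := sum_cols_le hz hs.isMatching
  refine ⟨fun p hp => ?_, fun i hi => ?_, fun b hb => ?_⟩
  · have := (Finset.sum_eq_zero_iff_of_nonneg h0).1 (by linarith) p hp
    linarith
  · by_contra! h
    linarith [sum_rows_add_le hy hs.isMatching h]
  · by_contra! h
    linarith [sum_cols_add_le hz hs.isMatching h]

-- With `c` the increment of the optimal value, cost minus `c` times size is minimal exactly at the
-- optimal assignments of sizes j and j + 1. All of these use every row of F, so they stay minimal
-- when the entries in the rows F are raised by a small ε. Egerváry's theorem for the raised matrix,
-- with ε added back to the row potentials on F, makes them positive there.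
open Filter Topology in
theorem IsGeneric.exists_isPotential (hA : IsGeneric Z A) (hj : j + 1 ≤ min m n)
    (hZ : ∀ s, IsAssignment (j + 1) s → ¬ s ⊆ Z) :
    ∃ c y z, IsPotential A j c y z := by
  classical
  set c := optValue A (j + 1) - optValue A j with hc
  set F := commonRows A j with hF
  have hnest := hA.commonRows_subset_succ hj hZ
  have hgap : ∀ s, IsMatching s →
      optValue A j - j * c < cost A s - s.card * c ∨
        optValue A j - j * c = cost A s - s.card * c ∧ ∀ f ∈ F, ∃ p ∈ s, p.1 = f := by
    intro s hs
    have ha := hs.isAssignment rfl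
    have hv := ha.optValue_le (A := A)
    by_cases h1 : s.card = j
    · rw [h1] at ha hv ⊢
      rcases hv.lt_or_eq with h | h
      · left; linarith
      · exact Or.inr ⟨by rw [h], fun f hf =>
          usesRow_iff.1 (mem_commonRows.1 hf s (ha.isOptimal h.ge))⟩
    by_cases h2 : s.card = j + 1
    · rw [h2] at ha hv ⊢
      push_cast
      rcases hv.lt_or_eq with h | h
      · left; linarith
      · exact Or.inr ⟨by rw [← h]; linarith, fun f hf =>
          usesRow_iff.1 (mem_commonRows.1 (hnest hf) s (ha.isOptimal h.ge))⟩
    · left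
      -- Strict convexity on both sides of the step from j to j + 1 excludes all other sizes.
      refine lt_of_lt_of_le (lt_of_convex (v := optValue A) (N := min m n)
        (fun l hl => optValue_convex A hl) hj ?_ ?_ ha.le_min h1 h2) (by linarith)
      · rintro l rfl
        exact hA.optValue_strict_convex hj hZ
      · intro h
        exact hA.optValue_strict_convex h (not_subset_of_le (by omega) hZ)
  have hev : ∀ᶠ ε : ℝ in 𝓝[>] 0, ∀ s : Finset (Fin m × Fin n), IsMatching s →
      optValue A j - j * c + ε * F.card ≤
        cost A s - s.card * c + ε * {p ∈ s | p.1 ∈ F}.card := by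
    rw [eventually_all]
    intro s
    by_cases hs : IsMatching s
    · rcases hgap s hs with h | ⟨h, hfull⟩
      · have ht : Tendsto (fun ε : ℝ => optValue A j - j * c + ε * F.card) (𝓝[>] 0)
            (𝓝 (optValue A j - j * c + 0 * F.card)) :=
          ((continuous_const.add (continuous_id.mul continuous_const)).tendsto 0).mono_left
            nhdsWithin_le_nhds
        have h' : optValue A j - j * c + 0 * F.card < cost A s - s.card * c := by linarith
        filter_upwards [ht.eventually_lt_const h', self_mem_nhdsWithin] with ε hε hε0 _
        have : 0 ≤ ε * ({p ∈ s | p.1 ∈ F}.card : ℝ) :=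
          mul_nonneg (le_of_lt hε0) (Nat.cast_nonneg _)
        linarith
      · filter_upwards [self_mem_nhdsWithin] with ε hε0 _
        have hcard : F.card ≤ {p ∈ s | p.1 ∈ F}.card := by
          refine le_trans (Finset.card_le_card ?_) (Finset.card_image_le (f := Prod.fst))
          intro f hf
          obtain ⟨p, hp, rfl⟩ := hfull f hf
          exact Finset.mem_image.2 ⟨p, Finset.mem_filter.2 ⟨hp, hf⟩, rfl⟩
        have : ε * (F.card : ℝ) ≤ ε * ({p ∈ s | p.1 ∈ F}.card : ℝ) :=
          mul_le_mul_of_nonneg_left (by exact_mod_cast hcard) (le_of_lt hε0)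
        linarith
    · simp [hs]
  obtain ⟨ε, hε, hε0⟩ := (hev.and self_mem_nhdsWithin).exists
  have hε0 : 0 < ε := hε0
  obtain ⟨y, z, M, hyz, hM, hsum⟩ := exists_weightCover_eq_matching
    fun i b => c - A i b - if i ∈ F then ε else 0
  have hMsum : ∑ p ∈ M, (c - A p.1 p.2 - if p.1 ∈ F then ε else 0) =
      M.card * c - cost A M - ε * {p ∈ M | p.1 ∈ F}.card := by
    rw [Finset.sum_sub_distrib, Finset.sum_sub_distrib, Finset.sum_const, nsmul_eq_mul,
      ← Finset.sum_filter, Finset.sum_const, nsmul_eq_mul, cost]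
    ring
  have hle : ∀ i b, c ≤ A i b + (y i + if i ∈ F then ε else 0) + z b := fun i b => by
    linarith [hyz.le_add i b]
  have hy0 : ∀ i, 0 ≤ y i + if i ∈ F then ε else 0 := fun i => by
    have := hyz.row_nonneg i
    split_ifs <;> linarith
  have hYsum : ∑ i, (y i + if i ∈ F then ε else 0) = ∑ i, y i + ε * F.card := by
    rw [Finset.sum_add_distrib]
    simp [mul_comm]
  obtain ⟨s, hs⟩ := exists_isOptimal A (show j ≤ min m n by omega)
  have hw := weak_duality hy0 hyz.col_nonneg hle hs.1
  rw [hs.cost_eq] at hw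
  have hM' := hε M hM
  have hval : j * c - (∑ i, (y i + if i ∈ F then ε else 0) + ∑ b, z b) = optValue A j := by
    refine le_antisymm hw ?_
    rw [hYsum]
    linarith
  refine ⟨c, fun i => y i + if i ∈ F then ε else 0, z, ?_, hy0, hyz.col_nonneg, hle, hval, ?_, ?_⟩
  · linarith [hA.optValue_lt_succ hj hZ]
  · linarith
  · intro i hi
    have := hyz.row_nonneg i
    have hi' : i ∈ F := hi
    simp only [hi', if_true]
    linarith

end Optimal

/-! ### How the common rows grow with the size -/

section Structure

variable {m n : ℕ} {A : Fin m → Fin n → ℝ} {Z : Finset (Fin m × Fin n)} {j k : ℕ}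
  {s t : Finset (Fin m × Fin n)} {c : ℝ} {y : Fin m → ℝ} {z : Fin n → ℝ}

open Classical in
/-- The columns with an element of `Z` outside the rows `F`. -/
noncomputable def zeroCols (Z : Finset (Fin m × Fin n)) (F : Finset (Fin m)) : Finset (Fin n) :=
  {b | ∃ i ∉ F, (i, b) ∈ Z}

theorem mem_zeroCols {F : Finset (Fin m)} {b : Fin n} :
    b ∈ zeroCols Z F ↔ ∃ i ∉ F, (i, b) ∈ Z := by
  simp [zeroCols]

theorem covers_zeroCols (Z : Finset (Fin m × Fin n)) (F : Finset (Fin m)) :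
    Covers Z F (zeroCols Z F) := by
  intro p hp
  by_cases h : p.1 ∈ F
  · exact Or.inl h
  · exact Or.inr (mem_zeroCols.2 ⟨p.1, h, hp⟩)

theorem IsMatching.insert (hs : IsMatching s) {q : Fin m × Fin n}
    (hq : ∀ p ∈ s, p.1 ≠ q.1 ∧ p.2 ≠ q.2) : IsMatching (insert q s) := by
  constructor
  · intro p hp p' hp' h
    rw [Finset.mem_coe, Finset.mem_insert] at hp hp'
    rcases hp with rfl | hp <;> rcases hp' with rfl | hp'
    · rfl
    · exact absurd h.symm (hq p' hp').1
    · exact absurd h (hq p hp).1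
    · exact hs.eq_of_fst hp hp' h
  · intro p hp p' hp' h
    rw [Finset.mem_coe, Finset.mem_insert] at hp hp'
    rcases hp with rfl | hp <;> rcases hp' with rfl | hp'
    · rfl
    · exact absurd h.symm (hq p' hp').2
    · exact absurd h (hq p hp).2
    · exact hs.eq_of_snd hp hp' h

theorem IsPotential.slackness (h : IsPotential A j c y z) (hs : IsOptimal A j s) :
    (∀ p ∈ s, A p.1 p.2 + y p.1 + z p.2 = c) ∧ (∀ i, 0 < y i → ∃ p ∈ s, p.1 = i) ∧
      ∀ b, 0 < z b → ∃ p ∈ s, p.2 = b :=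
  complementary_slackness h.row_nonneg h.col_nonneg h.le_add hs.1 (by rw [hs.cost_eq, h.value])

theorem IsPotential.slackness_succ (h : IsPotential A j c y z) (hs : IsOptimal A (j + 1) s) :
    (∀ p ∈ s, A p.1 p.2 + y p.1 + z p.2 = c) ∧ (∀ i, 0 < y i → ∃ p ∈ s, p.1 = i) ∧
      ∀ b, 0 < z b → ∃ p ∈ s, p.2 = b :=
  complementary_slackness h.row_nonneg h.col_nonneg h.le_add hs.1
    (by rw [hs.cost_eq, ← h.value_succ]; push_cast; ring)

theorem IsPotential.row_eq_zero (h : IsPotential A j c y z) {i : Fin m}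
    (hi : i ∉ commonRows A j) : y i = 0 := by
  rw [mem_commonRows] at hi
  push Not at hi
  obtain ⟨s, hs, hsi⟩ := hi
  by_contra hne
  exact hsi (usesRow_iff.2 ((h.slackness hs).2.1 i (lt_of_le_of_ne (h.row_nonneg i) (Ne.symm hne))))

theorem IsPotential.le_col (h : IsPotential A j c y z) (hA : IsGeneric Z A) {b : Fin n}
    (hb : b ∈ zeroCols Z (commonRows A j)) : c ≤ z b := by
  obtain ⟨i, hi, hib⟩ := mem_zeroCols.1 hb
  have h1 := h.le_add i b
  have h2 : A i b = 0 := hA.zero _ hib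
  rw [h.row_eq_zero hi, h2] at h1
  linarith

/-- In such a column `z` is already at least `c`, so tightness forces the entry and the row
potential to vanish. -/
theorem IsPotential.zero_of_mem_zeroCols (h : IsPotential A j c y z) (hA : IsGeneric Z A)
    {p : Fin m × Fin n} (hp : A p.1 p.2 + y p.1 + z p.2 = c)
    (hb : p.2 ∈ zeroCols Z (commonRows A j)) : p.1 ∉ commonRows A j ∧ p ∈ Z := by
  have h1 := h.le_col hA hb
  have h2 := h.row_nonneg p.1
  have h3 := hA.nonneg p
  constructor
  · intro hF
    linarith [h.row_pos _ hF]
  · by_contra hpZ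
    linarith [hA.pos p hpZ]

theorem card_filter_rows_eq (hs : IsMatching s) {F : Finset (Fin m)}
    (h : ∀ f ∈ F, ∃ p ∈ s, p.1 = f) : {p ∈ s | p.1 ∈ F}.card = F.card := by
  rw [← Finset.card_image_of_injOn (s := {p ∈ s | p.1 ∈ F}) (f := Prod.fst)
    (hs.rows.mono (by intro p hp; exact Finset.mem_coe.2 (Finset.mem_filter.1 hp).1))]
  congr 1
  ext i
  simp only [Finset.mem_image, Finset.mem_filter]
  constructor
  · rintro ⟨p, ⟨-, hp⟩, rfl⟩; exact hp
  · intro hi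
    obtain ⟨p, hp, rfl⟩ := h i hi
    exact ⟨p, ⟨hp, hi⟩, rfl⟩

theorem card_filter_cols_eq (hs : IsMatching s) {C : Finset (Fin n)}
    (h : ∀ b ∈ C, ∃ p ∈ s, p.2 = b) : {p ∈ s | p.2 ∈ C}.card = C.card := by
  rw [← Finset.card_image_of_injOn (s := {p ∈ s | p.2 ∈ C}) (f := Prod.snd)
    (hs.cols.mono (by intro p hp; exact Finset.mem_coe.2 (Finset.mem_filter.1 hp).1))]
  congr 1
  ext i
  simp only [Finset.mem_image, Finset.mem_filter]
  constructor
  · rintro ⟨p, ⟨-, hp⟩, rfl⟩; exact hp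
  · intro hi
    obtain ⟨p, hp, rfl⟩ := h i hi
    exact ⟨p, ⟨hp, hi⟩, rfl⟩

theorem card_eq_of_lines (hs : IsMatching s) {F : Finset (Fin m)} {C : Finset (Fin n)}
    (hF : ∀ f ∈ F, ∃ p ∈ s, p.1 = f) (hC : ∀ b ∈ C, ∃ p ∈ s, p.2 = b)
    (hFC : ∀ p ∈ s, p.2 ∈ C → p.1 ∉ F) :
    s.card = F.card + C.card + {p ∈ s | p.1 ∉ F ∧ p.2 ∉ C}.card := by
  have h1 := Finset.card_filter_add_card_filter_not (s := s) (fun p => p.1 ∈ F)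
  have h2 := Finset.card_filter_add_card_filter_not (s := {p ∈ s | p.1 ∉ F}) (fun p => p.2 ∈ C)
  rw [Finset.filter_filter, Finset.filter_filter] at h2
  have h3 : {p ∈ s | p.1 ∉ F ∧ p.2 ∈ C} = {p ∈ s | p.2 ∈ C} := by
    ext p
    simp only [Finset.mem_filter]
    have := hFC p
    tauto
  rw [h3, card_filter_cols_eq hs hC] at h2
  rw [card_filter_rows_eq hs hF] at h1
  omega

/-- The common rows of the optimal `j`-assignments and the columns of the remaining zeros are `j`
lines altogether. -/
theorem IsGeneric.card_commonRows_add (hA : IsGeneric Z A) (hj : j + 1 ≤ min m n)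
    (hZ : ∀ s, IsAssignment (j + 1) s → ¬ s ⊆ Z) :
    (commonRows A j).card + (zeroCols Z (commonRows A j)).card = j := by
  obtain ⟨c, y, z, h⟩ := hA.exists_isPotential hj hZ
  obtain ⟨s, hs⟩ := exists_isOptimal A (show j ≤ min m n by omega)
  obtain ⟨h1, h2, h3⟩ := h.slackness hs
  have := card_eq_of_lines hs.1.isMatching (F := commonRows A j)
    (C := zeroCols Z (commonRows A j))
    (fun f hf => h2 f (h.row_pos f hf))
    (fun b hb => h3 b (h.pos.trans_le (h.le_col hA hb)))
    (fun p hp hb => (h.zero_of_mem_zeroCols hA (h1 p hp) hb).1)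
  rw [hs.1.card_eq, Finset.filter_false_of_mem, Finset.card_empty] at this
  · omega
  -- A position off all these lines would be nonzero, and then its row would be common.
  · intro p hp ⟨hp1, hp2⟩
    have hpZ : p ∉ Z := fun hpZ => hp2 (mem_zeroCols.2 ⟨p.1, hp1, hpZ⟩)
    exact hp1 (hA.mem_commonRows_of_mem hs hp hpZ)

theorem card_le_of_covered (hs : IsMatching s) {R : Finset (Fin m)} {C : Finset (Fin n)}
    (h : ∀ p ∈ s, p.1 ∈ R ∨ p.2 ∈ C) : s.card ≤ R.card + C.card := by
  have h1 := Finset.card_filter_add_card_filter_not (s := s) (fun p => p.1 ∈ R)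
  have h2 : {p ∈ s | p.1 ∈ R}.card ≤ R.card :=
    Finset.card_le_card_of_injOn Prod.fst (fun p hp => (Finset.mem_filter.1 hp).2)
      (hs.rows.mono (by intro p hp; exact Finset.mem_coe.2 (Finset.mem_filter.1 hp).1))
  have h3 : {p ∈ s | p.1 ∉ R}.card ≤ C.card :=
    Finset.card_le_card_of_injOn Prod.snd
      (fun p hp => (h p (Finset.mem_filter.1 hp).1).resolve_left (Finset.mem_filter.1 hp).2)
      (hs.cols.mono (by intro p hp; exact Finset.mem_coe.2 (Finset.mem_filter.1 hp).1))
  omega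

/-- A cover that contains the common rows and one more row has more than `j` lines. -/
theorem IsGeneric.lt_card_cover (hA : IsGeneric Z A) {a : Fin m} (ha : a ∉ commonRows A j)
    {R : Finset (Fin m)} {C : Finset (Fin n)} (hR : commonRows A j ⊆ R) (haR : a ∈ R)
    (hc : Covers Z R C) : j < R.card + C.card := by
  rw [mem_commonRows] at ha
  push Not at ha
  obtain ⟨s, hs, hsa⟩ := ha
  -- The optimal j-assignment `s` avoids row `a`, so it is covered even without that row.
  have h := card_le_of_covered hs.1.isMatching (R := R.erase a) (C := C) fun p hp => by
    have hpa : p.1 ≠ a := fun h => hsa (usesRow_iff.2 ⟨p, hp, h⟩)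
    by_cases hpZ : p ∈ Z
    · exact (hc p hpZ).imp_left fun h => Finset.mem_erase.2 ⟨hpa, h⟩
    · exact Or.inl (Finset.mem_erase.2 ⟨hpa, hR (hA.mem_commonRows_of_mem hs hp hpZ)⟩)
  rw [hs.1.card_eq, Finset.card_erase_of_mem haR] at h
  have : 0 < R.card := Finset.card_pos.2 ⟨a, haR⟩
  omega

/-- Some optimal `k`-assignment has a position outside `Z` in the row `a`. -/
def HasNonzeroInRow (A : Fin m → Fin n → ℝ) (Z : Finset (Fin m × Fin n)) (k : ℕ) (a : Fin m) :
    Prop :=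
  ∃ s, IsOptimal A k s ∧ ∃ b, (a, b) ∈ s ∧ (a, b) ∉ Z

theorem IsGeneric.mem_commonRows_of_hasNonzero (hA : IsGeneric Z A) {a : Fin m}
    (h : HasNonzeroInRow A Z k a) : a ∈ commonRows A k := by
  obtain ⟨s, hs, b, hb, hbZ⟩ := h
  exact hA.mem_commonRows_of_mem hs hb hbZ

theorem hasNonzeroInRow_of_mem_commonRows (hk : k ≤ min m n) {r : Fin m}
    (hr : ∀ b, (r, b) ∉ Z) (h : r ∈ commonRows A k) : HasNonzeroInRow A Z k r := by
  obtain ⟨s, hs⟩ := exists_isOptimal A hk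
  obtain ⟨b, hb⟩ := mem_commonRows.1 h s hs
  exact ⟨s, hs, b, hb, hr b⟩

/-- The shape of an optimal `(j + 1)`-assignment relative to the common rows of the optimal
`j`-assignments. -/
theorem IsGeneric.exists_new_position (hA : IsGeneric Z A) (hj : j + 1 ≤ min m n)
    (hZ : ∀ s, IsAssignment (j + 1) s → ¬ s ⊆ Z) (hs : IsOptimal A (j + 1) s) :
    (∀ f ∈ commonRows A j, ∃ p ∈ s, p.1 = f) ∧
    (∀ p ∈ s, p.2 ∈ zeroCols Z (commonRows A j) → p.1 ∉ commonRows A j ∧ p ∈ Z) ∧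
    ∃ q ∈ s, q.1 ∉ commonRows A j ∧ q.2 ∉ zeroCols Z (commonRows A j) ∧
      ∀ p ∈ s, p.1 ∉ commonRows A j → p ∉ Z → p = q := by
  obtain ⟨c, y, z, h⟩ := hA.exists_isPotential hj hZ
  obtain ⟨h1, h2, h3⟩ := h.slackness_succ hs
  have hF : ∀ f ∈ commonRows A j, ∃ p ∈ s, p.1 = f := fun f hf => h2 f (h.row_pos f hf)
  have hC : ∀ p ∈ s, p.2 ∈ zeroCols Z (commonRows A j) → p.1 ∉ commonRows A j ∧ p ∈ Z :=
    fun p hp hb => h.zero_of_mem_zeroCols hA (h1 p hp) hb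
  have hcard := card_eq_of_lines hs.1.isMatching hF
    (fun b hb => h3 b (h.pos.trans_le (h.le_col hA hb))) fun p hp hb => (hC p hp hb).1
  -- The j lines hold one position each, which leaves exactly one of the j + 1 positions.
  rw [hs.1.card_eq, hA.card_commonRows_add hj hZ] at hcard
  obtain ⟨q, hq⟩ := Finset.card_eq_one.1 (show
    {p ∈ s | p.1 ∉ commonRows A j ∧ p.2 ∉ zeroCols Z (commonRows A j)}.card = 1 by omega)
  have hq' := hq ▸ Finset.mem_singleton_self q
  rw [Finset.mem_filter] at hq'
  refine ⟨hF, hC, q, hq'.1, hq'.2.1, hq'.2.2, fun p hp hpF hpZ => ?_⟩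
  rw [← Finset.mem_singleton, ← hq]
  exact Finset.mem_filter.2 ⟨hp, hpF, fun hb => hpZ (hC p hp hb).2⟩

theorem IsGeneric.existsUnique_newRow (hA : IsGeneric Z A) (hj : j + 1 ≤ min m n)
    (hZ : ∀ s, IsAssignment (j + 1) s → ¬ s ⊆ Z) :
    ∃! a, a ∉ commonRows A j ∧ HasNonzeroInRow A Z (j + 1) a := by
  obtain ⟨s, hs⟩ := exists_isOptimal A hj
  obtain ⟨-, -, q, hq, hqF, hqC, huniq⟩ := hA.exists_new_position hj hZ hs
  refine ⟨q.1, ⟨hqF, s, hs, q.2, hq, fun hqZ => hqC (mem_zeroCols.2 ⟨q.1, hqF, hqZ⟩)⟩, ?_⟩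
  rintro a ⟨haF, t, ht, b, hb, hbZ⟩
  rw [← huniq (a, b) (hA.mem_of_isOptimal ht hs hb hbZ) haF hbZ]

/-- Exchange the rows `a` and `a'` in all columns outside `C`. -/
def swapRows (C : Finset (Fin n)) (a a' : Fin m) (A : Fin m → Fin n → ℝ) : Fin m → Fin n → ℝ :=
  fun i b => if b ∈ C then A i b else A (Equiv.swap a a' i) b

/-- The old potential remains feasible, since the row potentials vanish outside F. It certifies the
old optimal j-assignments, which lie on unchanged lines, and the line count excludes any loss of
common rows. -/
theorem IsGeneric.swapRows_invariant (hA : IsGeneric Z A) (hj : j + 1 ≤ min m n)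
    (hZ : ∀ s, IsAssignment (j + 1) s → ¬ s ⊆ Z) {a a' : Fin m} (ha : a ∉ commonRows A j)
    (ha' : a' ∉ commonRows A j) (hnew : HasNonzeroInRow A Z (j + 1) a)
    (hA' : IsGeneric Z (swapRows (zeroCols Z (commonRows A j)) a a' A)) :
    commonRows (swapRows (zeroCols Z (commonRows A j)) a a' A) j = commonRows A j ∧
      HasNonzeroInRow (swapRows (zeroCols Z (commonRows A j)) a a' A) Z (j + 1) a' := by
  obtain ⟨c, y, z, h⟩ := hA.exists_isPotential hj hZ
  set F := commonRows A j with hF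
  set C := zeroCols Z F with hC
  set A' := swapRows C a a' A with hA'def
  have hsame : ∀ p : Fin m × Fin n, p.1 ∈ F ∨ p.2 ∈ C → A' p.1 p.2 = A p.1 p.2 := by
    intro p hp
    by_cases hb : p.2 ∈ C
    · simp [hA'def, swapRows, hb]
    · have hpF := hp.resolve_right hb
      have h1 : p.1 ≠ a := fun h => ha (h ▸ hpF)
      have h2 : p.1 ≠ a' := fun h => ha' (h ▸ hpF)
      simp [hA'def, swapRows, Equiv.swap_apply_of_ne_of_ne h1 h2]
  have hle : ∀ i b, c ≤ A' i b + y i + z b := by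
    intro i b
    by_cases hib : i ∈ F ∨ b ∈ C
    · rw [hsame (i, b) hib]; exact h.le_add i b
    · push Not at hib
      have hi' : Equiv.swap a a' i ∉ F := by
        by_cases h1 : i = a
        · simpa [h1] using ha'
        by_cases h2 : i = a'
        · simpa [h2] using ha
        · simpa [Equiv.swap_apply_of_ne_of_ne h1 h2] using hib.1
      have := h.le_add (Equiv.swap a a' i) b
      rw [h.row_eq_zero hi'] at this
      rw [h.row_eq_zero hib.1]
      simpa [hA'def, swapRows, hib.2] using this
  have hcover : ∀ t, IsOptimal A j t → ∀ p ∈ t, p.1 ∈ F ∨ p.2 ∈ C := by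
    intro t ht p hp
    by_cases hpZ : p ∈ Z
    · exact covers_zeroCols Z F p hpZ
    · exact Or.inl (hA.mem_commonRows_of_mem ht hp hpZ)
  have hopt : ∀ t, IsOptimal A j t → IsOptimal A' j t := by
    intro t ht
    refine ⟨ht.1, fun u hu => ?_⟩
    have h1 : cost A' t = cost A t :=
      Finset.sum_congr rfl fun p hp => hsame p (hcover t ht p hp)
    rw [h1, ht.cost_eq, ← h.value]
    exact weak_duality h.row_nonneg h.col_nonneg hle hu
  constructor
  · refine Finset.Subset.antisymm (fun i hi => ?_) fun f hf => ?_
    · exact mem_commonRows.2 fun t ht => mem_commonRows.1 hi t (hopt t ht)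
    · by_contra hf'
      have := hA'.lt_card_cover hf' (R := F) (C := C)
        (fun i hi => mem_commonRows.2 fun t ht => mem_commonRows.1 hi t (hopt t ht)) hf
        (covers_zeroCols Z F)
      rw [hF, hC, hF, hA.card_commonRows_add hj hZ] at this
      exact lt_irrefl _ this
  · obtain ⟨s, hs, b, hb, hbZ⟩ := hnew
    obtain ⟨hsF, hsC, q, hq, hqF, hqC, huniq⟩ := hA.exists_new_position hj hZ hs
    obtain rfl := huniq _ hb ha hbZ
    have hat := ha'
    rw [hF, mem_commonRows] at hat
    push Not at hat
    obtain ⟨t, ht, hta⟩ := hat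
    obtain ⟨t1, t2, -⟩ := h.slackness ht
    -- The new (j+1)-assignment takes the rows F from `s`, the zeros in the columns C from an
    -- optimal j-assignment `t` that misses `a'`, and the position `(a', b)`, whose entry is now the
    -- old `A a b`.
    set s' : Finset (Fin m × Fin n) := {p ∈ s | p.1 ∈ F} with hs'
    have hs's : s' ⊆ s := Finset.filter_subset _ _
    have hsplit_t : SplitsAt t F Cᶜ := fun p hp => by
      rw [Finset.mem_compl]
      exact ⟨fun hpF hpC => (h.zero_of_mem_zeroCols hA (t1 p hp) hpC).1 hpF,
        fun hpC => (hcover t ht p hp).resolve_right hpC⟩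
    have hsplit_s : SplitsAt s' F Cᶜ := fun p hp => by
      have hpF := (Finset.mem_filter.1 hp).2
      rw [Finset.mem_compl]
      exact ⟨fun _ hpC => (hsC p (hs's hp) hpC).1 hpF, fun _ => hpF⟩
    have hM := ht.1.isMatching.replaceOn (hs.1.isMatching.subset hs's) hsplit_t hsplit_s
    have hs'F : {p ∈ s' | p.1 ∈ F} = s' :=
      Finset.filter_true_of_mem fun p hp => (Finset.mem_filter.1 hp).2
    have hmem : ∀ p ∈ replaceOn t s' F, p.1 ≠ a' ∧ p.2 ≠ b := by
      intro p hp
      rcases Finset.mem_union.1 hp with hp | hp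
      · obtain ⟨hp, hpF⟩ := Finset.mem_filter.1 hp
        refine ⟨fun h => hta (usesRow_iff.2 ⟨p, hp, h⟩), fun h => hqC ?_⟩
        rw [← h]
        exact (hcover t ht p hp).resolve_left hpF
      · rw [hs'F] at hp
        obtain ⟨hp, hpF⟩ := Finset.mem_filter.1 hp
        refine ⟨fun h => ha' (h ▸ hpF), fun h => ha ?_⟩
        rw [hs.1.isMatching.eq_of_snd hp hb h] at hpF
        exact hpF
    have hnot : (a', b) ∉ replaceOn t s' F := fun hp => (hmem _ hp).1 rfl
    have hcard : (insert (a', b) (replaceOn t s' F)).card = j + 1 := by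
      rw [Finset.card_insert_of_notMem hnot, card_replaceOn, hs'F, hs',
        card_filter_rows_eq hs.1.isMatching hsF]
      have h1 := card_filter_rows_eq ht.1.isMatching fun f hf => t2 f (h.row_pos f hf)
      have h2 := Finset.card_filter_add_card_filter_not (s := t) (fun p => p.1 ∈ F)
      rw [ht.1.card_eq] at h2
      rw [← hF] at h1 ⊢
      omega
    have hassign := (hM.insert hmem).isAssignment hcard
    have hcost : cost A' (insert (a', b) (replaceOn t s' F)) ≤ cost A s := by
      have e1 : cost A' (insert (a', b) (replaceOn t s' F)) = A a b + ∑ p ∈ s', A p.1 p.2 := by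
        rw [cost, Finset.sum_insert hnot, sum_replaceOn, hs'F]
        have z1 : ∑ p ∈ t with p.1 ∉ F, A' p.1 p.2 = 0 := by
          refine Finset.sum_eq_zero fun p hp => ?_
          obtain ⟨hp, hpF⟩ := Finset.mem_filter.1 hp
          rw [hsame p (hcover t ht p hp)]
          refine hA.zero p ?_
          by_contra hpZ
          exact hpF (hA.mem_commonRows_of_mem ht hp hpZ)
        have z2 : ∑ p ∈ s', A' p.1 p.2 = ∑ p ∈ s', A p.1 p.2 :=
          Finset.sum_congr rfl fun p hp => hsame p (Or.inl (Finset.mem_filter.1 hp).2)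
        have z3 : A' a' b = A a b := by
          have hbC : b ∉ C := hqC
          simp [hA'def, swapRows, hbC]
        rw [z1, z2, zero_add, z3]
      have hns : (a, b) ∉ s' := fun h => ha (Finset.mem_filter.1 h).2
      rw [e1, ← Finset.sum_insert (f := fun p : Fin m × Fin n => A p.1 p.2) hns]
      exact Finset.sum_le_sum_of_subset_of_nonneg (Finset.insert_subset hb hs's)
        fun p _ _ => hA.nonneg p
    refine ⟨_, ⟨hassign, fun u hu => ?_⟩, b, Finset.mem_insert_self _ _, ?_⟩
    · refine hcost.trans ?_
      rw [hs.cost_eq, ← h.value_succ]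
      have := weak_duality h.row_nonneg h.col_nonneg hle hu
      push_cast at this
      exact this
    · exact fun hz => hqC (mem_zeroCols.2 ⟨a', ha', hz⟩)

end Structure

/-! ### Uniformly random orders -/

section RowOrder

/-- The probability that, in a uniformly random order of `M` objects, the objects before a given
one form a given set of `i` others. -/
noncomputable def orderWeight (M i : ℕ) : ℝ := 1 / (M * (M - 1).choose i)

theorem orderWeight_zero (M : ℕ) : orderWeight (M + 1) 0 = 1 / (M + 1) := by
  simp [orderWeight]

theorem orderWeight_succ (M i : ℕ) (hi : i ≤ M) :
    orderWeight (M + 2) (i + 1) = 1 / (M + 2) * ((i + 1) * orderWeight (M + 1) i) := by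
  have h := Nat.add_one_mul_choose_eq M i
  have h1 : ((M : ℝ) + 1) * M.choose i = (M + 1).choose (i + 1) * (i + 1) := by exact_mod_cast h
  have h2 : (0 : ℝ) < M.choose i := by exact_mod_cast Nat.choose_pos hi
  have h3 : (0 : ℝ) < (M + 1).choose (i + 1) := by
    exact_mod_cast Nat.choose_pos (Nat.succ_le_succ hi)
  simp only [orderWeight, Nat.add_sub_cancel, show M + 2 - 1 = M + 1 by omega]
  push_cast
  rw [h1]
  field_simp

theorem orderWeight_add (M i : ℕ) (hi : i ≤ M) :
    orderWeight (M + 2) i + orderWeight (M + 2) (i + 1) = orderWeight (M + 1) i := by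
  have h := Nat.add_one_mul_choose_eq M i
  have h1 : ((M : ℝ) + 1) * M.choose i = (M + 1).choose (i + 1) * (i + 1) := by exact_mod_cast h
  have h' := Nat.choose_mul_succ_eq M i
  have h1' : (M.choose i : ℝ) * (M + 1) = (M + 1).choose i * (M + 1 - i) := by
    rw [← Nat.cast_add_one, ← Nat.cast_sub (by omega)]
    exact_mod_cast h'
  have h2 : (0 : ℝ) < M.choose i := by exact_mod_cast Nat.choose_pos hi
  have h3 : (0 : ℝ) < (M + 1).choose (i + 1) := by
    exact_mod_cast Nat.choose_pos (Nat.succ_le_succ hi)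
  have h4 : (0 : ℝ) < (M + 1).choose i := by
    exact_mod_cast Nat.choose_pos (hi.trans (Nat.le_succ M))
  have h5 : (0 : ℝ) < M + 1 - i := by
    have : (i : ℝ) ≤ M := by exact_mod_cast hi
    linarith
  have e1 : (1 : ℝ) / (M + 1).choose (i + 1) = (i + 1) / ((M + 1) * M.choose i) := by
    rw [h1]; field_simp
  have e2 : (1 : ℝ) / (M + 1).choose i = (M + 1 - i) / ((M + 1) * M.choose i) := by
    rw [mul_comm ((M : ℝ) + 1), h1']; field_simp
  simp only [orderWeight, Nat.add_sub_cancel, show M + 2 - 1 = M + 1 by omega]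
  push_cast
  rw [← one_div_mul_one_div, ← one_div_mul_one_div, e1, e2]
  field_simp
  ring

variable {α : Type*} [DecidableEq α]

/-- Conditioning on the first object: it is the given one, or some `a` in `U`, each with probability
`1 / (U.card + 1)`. -/
theorem sum_orderWeight_first (U : Finset α) (f : Finset α → ℝ) :
    ∑ T ∈ U.powerset, orderWeight (U.card + 1) T.card * f T =
      1 / (U.card + 1) * (f ∅ + ∑ a ∈ U, ∑ S ∈ (U.erase a).powerset,
        orderWeight U.card S.card * f (insert a S)) := by
  have key : ∑ a ∈ U, ∑ S ∈ (U.erase a).powerset, orderWeight U.card S.card * f (insert a S) =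
      ∑ T ∈ U.powerset, ∑ _a ∈ T, orderWeight U.card (T.card - 1) * f T := by
    rw [Finset.sum_sigma', Finset.sum_sigma']
    refine Finset.sum_bij' (fun x _ => ⟨insert x.1 x.2, x.1⟩) (fun x _ => ⟨x.2, x.1.erase x.2⟩)
      ?_ ?_ ?_ ?_ ?_
    · rintro ⟨a, S⟩ h
      simp only [Finset.mem_sigma, Finset.mem_powerset, Finset.subset_erase] at h ⊢
      exact ⟨Finset.insert_subset h.1 h.2.1, Finset.mem_insert_self _ _⟩
    · rintro ⟨T, a⟩ h
      simp only [Finset.mem_sigma, Finset.mem_powerset] at h ⊢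
      exact ⟨h.1 h.2, Finset.erase_subset_erase _ h.1⟩
    · rintro ⟨a, S⟩ h
      simp only [Finset.mem_sigma, Finset.mem_powerset, Finset.subset_erase] at h
      simp [Finset.erase_insert h.2.2]
    · rintro ⟨T, a⟩ h
      simp only [Finset.mem_sigma, Finset.mem_powerset] at h
      simp [Finset.insert_erase h.2]
    · rintro ⟨a, S⟩ h
      simp only [Finset.mem_sigma, Finset.mem_powerset, Finset.subset_erase] at h
      simp [Finset.card_insert_of_notMem h.2.2]
  rw [key, mul_add, Finset.mul_sum,
    ← Finset.add_sum_erase _ _ (Finset.empty_mem_powerset U),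
    ← Finset.add_sum_erase (a := ∅) _ (fun T => 1 / ((U.card : ℝ) + 1) *
      ∑ _a ∈ T, orderWeight U.card (T.card - 1) * f T) (Finset.empty_mem_powerset U)]
  simp only [Finset.card_empty, orderWeight_zero, Finset.sum_empty, mul_zero, zero_add]
  congr 1
  refine Finset.sum_congr rfl fun T hT => ?_
  simp only [Finset.mem_erase, Finset.mem_powerset] at hT
  obtain ⟨i, hi⟩ : ∃ i, T.card = i + 1 :=
    ⟨T.card - 1, by have := Finset.card_pos.2 (Finset.nonempty_iff_ne_empty.2 hT.1); omega⟩
  have hle := Finset.card_le_card hT.2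
  obtain ⟨M, hM⟩ : ∃ M, U.card = M + 1 := ⟨U.card - 1, by omega⟩
  rw [Finset.sum_const, hi, hM, orderWeight_succ M i (by omega), nsmul_eq_mul,
    Nat.add_sub_cancel]
  push_cast
  ring

/-- Deleting an object from a uniformly random order leaves a uniformly random order of the others.
-/
theorem sum_orderWeight_forget (U : Finset α) (f : Finset α → ℝ) {e : α} (he : e ∈ U)
    (hf : ∀ S ⊆ U.erase e, f (insert e S) = f S) :
    ∑ T ∈ U.powerset, orderWeight (U.card + 1) T.card * f T =
      ∑ S ∈ (U.erase e).powerset, orderWeight U.card S.card * f S := by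
  conv_lhs => rw [← Finset.insert_erase he]
  rw [Finset.sum_powerset_insert (Finset.notMem_erase e U), ← Finset.sum_add_distrib]
  refine Finset.sum_congr rfl fun S hS => ?_
  rw [Finset.mem_powerset] at hS
  have heS : e ∉ S := fun h => Finset.notMem_erase e U (hS h)
  have hcard := Finset.card_le_card hS
  rw [Finset.insert_erase he, hf S hS, Finset.card_insert_of_notMem heS, ← add_mul]
  rw [Finset.card_erase_of_mem he] at hcard
  have : 0 < U.card := Finset.card_pos.2 ⟨e, he⟩
  obtain ⟨M, hM⟩ : ∃ M, U.card = M + 1 := ⟨U.card - 1, by omega⟩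
  rw [hM, orderWeight_add M _ (by omega)]

end RowOrder

/-! ### Small covers, uncrossing and the order probability -/

section Covers

variable {m n : ℕ} {Z : Finset (Fin m × Fin n)} {k : ℕ} {r : Fin m}

/-- The rows `B` can be completed to a cover of `Z` with fewer than `k` lines. -/
def HasSmallCover (Z : Finset (Fin m × Fin n)) (k : ℕ) (B : Finset (Fin m)) : Prop :=
  ∃ (R : Finset (Fin m)) (C : Finset (Fin n)), B ⊆ R ∧ Covers Z R C ∧ R.card + C.card < k

theorem HasSmallCover.mono {B B' : Finset (Fin m)} (h : HasSmallCover Z k B') (hB : B ⊆ B') :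
    HasSmallCover Z k B := by
  obtain ⟨R, C, h1, h2⟩ := h
  exact ⟨R, C, hB.trans h1, h2⟩

/-- A smaller cover can be padded with rows to exactly k - 1 lines; `k ≤ m` provides enough of them.
-/
theorem isPartialCover_iff (hk : k ≤ m) (B : Finset (Fin m)) :
    IsPartialCover Z k B ∅ ↔ HasSmallCover Z k B := by
  constructor
  · rintro ⟨R, C, h1, -, h2, h3⟩
    exact ⟨R, C, h1, h2, by omega⟩
  · rintro ⟨R, C, h1, h2, h3⟩
    obtain ⟨R', hR, hcard⟩ := Finset.exists_superset_card_eq (s := R) (n := k - 1 - C.card)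
      (by omega) (by rw [Fintype.card_fin]; omega)
    exact ⟨R', C, h1.trans hR, Finset.empty_subset _, fun p hp => (h2 p hp).imp_left (@hR _),
      by omega⟩

/-- Uncrossing: enlarging `B` to `F` does not affect which further rows can be added, if `F` belongs
to a cover that is minimal among those with the rows `B`. -/
theorem HasSmallCover.union {B F S : Finset (Fin m)} {C : Finset (Fin n)} {q : ℕ} (hBF : B ⊆ F)
    (hF : Covers Z F C) (hcard : F.card + C.card ≤ q)
    (hB : ∀ R C, B ⊆ R → Covers Z R C → q ≤ R.card + C.card) (h : HasSmallCover Z k (B ∪ S)) :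
    HasSmallCover Z k (F ∪ S) := by
  obtain ⟨R, C', h1, h2, h3⟩ := h
  refine ⟨R ∪ F, C' ∩ C, ?_, ?_, ?_⟩
  · exact Finset.union_subset Finset.subset_union_right
      ((Finset.subset_union_right.trans h1).trans Finset.subset_union_left)
  · intro p hp
    have := h2 p hp
    have := hF p hp
    simp only [Finset.mem_union, Finset.mem_inter]
    tauto
  -- The two uncrossed covers have together as many lines as the original two; the other one has at
  -- least `q`, so this one is no larger than `(R, C')`.
  · have := hB (R ∩ F) (C' ∪ C)
      (Finset.subset_inter (Finset.subset_union_left.trans h1) hBF) (by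
        intro p hp
        have := h2 p hp
        have := hF p hp
        simp only [Finset.mem_union, Finset.mem_inter]
        tauto)
    have e1 := Finset.card_union_add_card_inter R F
    have e2 := Finset.card_union_add_card_inter C' C
    omega

open Classical in
/-- The probability that, if the rows outside `B` are put in uniformly random order, the rows before
`r` together with `B` have a small cover. -/
noncomputable def orderProb (Z : Finset (Fin m × Fin n)) (k : ℕ) (r : Fin m)
    (B : Finset (Fin m)) : ℝ :=
  if r ∈ B then 1 else ∑ S ∈ (Bᶜ.erase r).powerset,
    orderWeight Bᶜ.card S.card * if HasSmallCover Z k (B ∪ S) then 1 else 0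

theorem orderProb_of_mem {B : Finset (Fin m)} (h : r ∈ B) : orderProb Z k r B = 1 := if_pos h

theorem orderProb_of_not {B : Finset (Fin m)} (hr : r ∉ B) (h : ¬ HasSmallCover Z k B) :
    orderProb Z k r B = 0 := by
  rw [orderProb, if_neg hr]
  refine Finset.sum_eq_zero fun S _ => ?_
  rw [if_neg fun h' => h (h'.mono Finset.subset_union_left), mul_zero]

theorem card_compl_eq {B : Finset (Fin m)} (hr : r ∉ B) : Bᶜ.card = (Bᶜ.erase r).card + 1 :=
  (Finset.card_erase_add_one (Finset.mem_compl.2 hr)).symm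

theorem compl_insert_erase {B : Finset (Fin m)} (a : Fin m) :
    (insert a B)ᶜ.erase r = (Bᶜ.erase r).erase a := by
  rw [Finset.compl_insert, Finset.erase_right_comm]

/-- Averaging over the first row of the random order. -/
theorem sum_orderProb_insert (B : Finset (Fin m)) (h : HasSmallCover Z k B) :
    ∑ a ∈ Bᶜ, orderProb Z k r (insert a B) = Bᶜ.card * orderProb Z k r B := by
  classical
  by_cases hr : r ∈ B
  · rw [orderProb_of_mem hr, mul_one, Finset.sum_congr rfl fun a _ =>
      orderProb_of_mem (Finset.mem_insert_of_mem hr)]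
    simp
  · set U := Bᶜ.erase r with hU
    have hc := card_compl_eq hr
    have key := sum_orderWeight_first U fun S => if HasSmallCover Z k (B ∪ S) then (1 : ℝ) else 0
    -- The term `a = r` is 1; it matches the orders in which `r` comes first, where `h` provides the
    -- small cover.
    rw [← Finset.add_sum_erase _ _ (Finset.mem_compl.2 hr),
      orderProb_of_mem (Finset.mem_insert_self _ _), orderProb, if_neg hr, ← hU, hc, key]
    have hpos : ((U.card + 1 : ℕ) : ℝ) ≠ 0 := by positivity
    rw [Nat.cast_add_one] at hpos ⊢
    rw [← mul_assoc, mul_one_div_cancel hpos, one_mul, Finset.union_empty, if_pos h]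
    congr 1
    refine Finset.sum_congr rfl fun a ha => ?_
    have har : a ≠ r := (Finset.mem_erase.1 ha).1
    have haB : a ∈ Bᶜ := (Finset.mem_erase.1 ha).2
    have hr' : r ∉ insert a B := by
      simp only [Finset.mem_insert, not_or]
      exact ⟨har.symm, hr⟩
    have hcard : (insert a B)ᶜ.card = U.card := by
      rw [Finset.compl_insert, Finset.card_erase_of_mem haB, hc, Nat.add_sub_cancel]
    rw [orderProb, if_neg hr', compl_insert_erase, hcard]
    refine Finset.sum_congr rfl fun S _ => ?_
    rw [Finset.union_insert, Finset.insert_union]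

/-- A row that can always be added without destroying a small cover is irrelevant to the event, so
it may be forgotten; the rows of `D` are added one at a time. -/
theorem orderProb_union_eq (B D : Finset (Fin m)) (hr : r ∉ B ∪ D)
    (h : ∀ S, HasSmallCover Z k (B ∪ S) → HasSmallCover Z k (B ∪ D ∪ S)) :
    orderProb Z k r (B ∪ D) = orderProb Z k r B := by
  classical
  induction D using Finset.induction_on with
  | empty => rw [Finset.union_empty]
  | insert e D _ ih =>
    rw [Finset.union_insert] at hr h ⊢
    have hr' : r ∉ B ∪ D := fun h => hr (Finset.mem_insert_of_mem h)
    have her : r ≠ e := fun h => hr (h ▸ Finset.mem_insert_self _ _)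
    rw [← ih hr' fun S hS => (h S hS).mono
      (Finset.union_subset_union (Finset.subset_insert _ _) (Finset.Subset.refl S))]
    by_cases he : e ∈ B ∪ D
    · rw [Finset.insert_eq_of_mem he]
    set B' := B ∪ D with hB'
    have heU : e ∈ B'ᶜ.erase r := Finset.mem_erase.2 ⟨her.symm, Finset.mem_compl.2 he⟩
    have hc := card_compl_eq hr'
    have hcard : (insert e B')ᶜ.card = (B'ᶜ.erase r).card := by
      rw [Finset.compl_insert, Finset.card_erase_of_mem (Finset.mem_compl.2 he), hc,
        Nat.add_sub_cancel]
    have hiff : ∀ S, HasSmallCover Z k (B' ∪ insert e S) ↔ HasSmallCover Z k (B' ∪ S) := by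
      intro S
      refine ⟨fun hS => hS.mono (Finset.union_subset_union_right (Finset.subset_insert _ _)),
        fun hS => ?_⟩
      have := h S (hS.mono (Finset.union_subset_union_left Finset.subset_union_left))
      rwa [Finset.insert_union, ← Finset.union_insert] at this
    rw [orderProb, orderProb, if_neg hr, if_neg hr', compl_insert_erase, hcard, hc,
      sum_orderWeight_forget _ _ heU fun S _ => by simp only [hiff]]
    refine Finset.sum_congr rfl fun S _ => ?_
    rw [Finset.insert_union, ← Finset.union_insert]
    simp only [hiff]

open Classical in
theorem coverCoeffAvoiding_eq (hk : k ≤ m) (i : ℕ) :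
    coverCoeffAvoiding Z k r i 0 =
      {S ∈ ((∅ : Finset (Fin m))ᶜ.erase r).powersetCard i | HasSmallCover Z k S}.card := by
  rw [coverCoeffAvoiding, ← Set.ncard_coe_finset, ← Set.ncard_image_of_injective _
    (f := fun S : Finset (Fin m) => (S, (∅ : Finset (Fin n)))) fun a b h => congrArg Prod.fst h]
  congr 1
  ext ⟨R, C⟩
  simp only [Set.mem_ofPred_eq, Finset.card_eq_zero, Finset.compl_empty, Finset.coe_filter,
    Finset.mem_powersetCard, Set.mem_image, Prod.mk.injEq, Finset.subset_erase,
    Finset.subset_univ, true_and]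
  constructor
  · rintro ⟨h1, h2, rfl, h3⟩
    exact ⟨R, ⟨⟨h3, h2⟩, (isPartialCover_iff hk R).1 h1⟩, rfl, rfl⟩
  · rintro ⟨S, ⟨⟨h3, h2⟩, h1⟩, rfl, rfl⟩
    exact ⟨(isPartialCover_iff hk S).2 h1, h2, rfl, h3⟩

theorem orderProb_empty (hk : k ≤ m) (r : Fin m) :
    orderProb Z k r ∅ = 1 / (m : ℝ) * ∑ i ∈ Finset.range k,
      (coverCoeffAvoiding Z k r i 0 : ℝ) / ((m - 1).choose i : ℝ) := by
  classical
  have hm : (∅ : Finset (Fin m))ᶜ.card = m := by simp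
  have hU : ((∅ : Finset (Fin m))ᶜ.erase r).card + 1 = m := by
    rw [← card_compl_eq (Finset.notMem_empty r), hm]
  rw [orderProb, if_neg (Finset.notMem_empty r), Finset.sum_powerset, hU, hm, Finset.mul_sum]
  have hterm : ∀ i, ∑ S ∈ ((∅ : Finset (Fin m))ᶜ.erase r).powersetCard i,
      (orderWeight m S.card * if HasSmallCover Z k (∅ ∪ S) then 1 else 0) =
      1 / (m : ℝ) * ((coverCoeffAvoiding Z k r i 0 : ℝ) / ((m - 1).choose i : ℝ)) := by
    intro i
    rw [coverCoeffAvoiding_eq hk, Finset.sum_congr rfl fun S hS => by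
      rw [(Finset.mem_powersetCard.1 hS).2, Finset.empty_union], ← Finset.mul_sum,
      Finset.sum_boole, orderWeight]
    ring
  rw [Finset.sum_congr rfl fun i _ => hterm i]
  -- Sets of `k` or more rows lie in no cover with fewer than `k` lines.
  refine (Finset.sum_subset (Finset.range_mono hk) fun i _ hi => ?_).symm
  rw [coverCoeffAvoiding_eq hk, Finset.filter_false_of_mem]
  · simp
  · rintro S hS ⟨R, C, h1, -, h3⟩
    rw [Finset.mem_powersetCard] at hS
    have := Finset.card_le_card h1
    rw [Finset.mem_range] at hi
    omega

end Covers

/-! ### The law of the entries, genericity and the symmetry of the new row -/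

section Law

variable {m n : ℕ} {Z : Finset (Fin m × Fin n)} {j k : ℕ}

instance isProbabilityMeasure_expMeasure_one : IsProbabilityMeasure (expMeasure 1) :=
  isProbabilityMeasure_expMeasure one_pos

theorem expMeasure_singleton (r u : ℝ) : expMeasure r {u} = 0 :=
  withDensity_absolutelyContinuous _ _ (measure_singleton u)

theorem expMeasure_Iic_zero (r : ℝ) : expMeasure r (Set.Iic 0) = 0 := by
  rw [← Set.Iio_union_right]
  refine measure_union_null ?_ (expMeasure_singleton r 0)
  rw [expMeasure, gammaMeasure, withDensity_apply _ measurableSet_Iio]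
  exact lintegral_exponentialPDF_of_nonpos le_rfl

/-- The joint law of the entries outside `Z`. -/
noncomputable def entryLaw (Z : Finset (Fin m × Fin n)) : Measure ({p // p ∉ Z} → ℝ) :=
  Measure.pi fun _ => expMeasure 1

instance isProbabilityMeasure_entryLaw : IsProbabilityMeasure (entryLaw Z) := by
  unfold entryLaw
  infer_instance

/-- The matrix with given entries outside `Z` and zeros in `Z`. -/
def matrixOf (Z : Finset (Fin m × Fin n)) (x : {p // p ∉ Z} → ℝ) : Fin m → Fin n → ℝ :=
  fun i b => if h : (i, b) ∉ Z then x ⟨(i, b), h⟩ else 0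

theorem matrixOf_of_mem {x : {p // p ∉ Z} → ℝ} {p : Fin m × Fin n} (hp : p ∈ Z) :
    matrixOf Z x p.1 p.2 = 0 := dif_neg (not_not.2 hp)

theorem matrixOf_of_notMem {x : {p // p ∉ Z} → ℝ} {p : Fin m × Fin n} (hp : p ∉ Z) :
    matrixOf Z x p.1 p.2 = x ⟨p, hp⟩ := dif_pos hp

theorem measurable_matrixOf (i : Fin m) (b : Fin n) :
    Measurable fun x : {p // p ∉ Z} → ℝ => matrixOf Z x i b := by
  by_cases h : (i, b) ∉ Z
  · simpa only [matrixOf, dif_pos h] using measurable_pi_apply _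
  · simpa only [matrixOf, dif_neg h] using measurable_const

theorem measurable_cost (s : Finset (Fin m × Fin n)) :
    Measurable fun x : {p // p ∉ Z} → ℝ => cost (matrixOf Z x) s :=
  Finset.measurable_sum _ fun p _ => measurable_matrixOf p.1 p.2

/-- A set whose sections in one coordinate are null sets is a null set. -/
theorem measure_pi_null_of_section {ι : Type*} [Fintype ι] [DecidableEq ι] {X : ι → Type*}
    [∀ i, MeasurableSpace (X i)] (μ : ∀ i, Measure (X i)) [∀ i, IsProbabilityMeasure (μ i)]
    {s : Set (∀ i, X i)} (hs : MeasurableSet s) (i : ι)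
    (h : ∀ x, μ i {u | Function.update x i u ∈ s} = 0) : Measure.pi μ s = 0 := by
  have hm : Measurable (s.indicator fun _ => (1 : ENNReal)) := measurable_const.indicator hs
  have hinner : ∀ x, ∫⁻ u, s.indicator (fun _ => (1 : ENNReal)) (Function.update x i u) ∂μ i = 0 := by
    intro x
    have hpre : MeasurableSet {u | Function.update x i u ∈ s} :=
      (measurable_update x) hs
    have e : ∀ u, s.indicator (fun _ => (1 : ENNReal)) (Function.update x i u) =
        {u | Function.update x i u ∈ s}.indicator (fun _ => 1) u := fun u => rfl
    simp only [e]
    exact (lintegral_indicator_one hpre).trans (h x)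
  rw [← lintegral_indicator_one hs]
  have hne : Nonempty (∀ i, X i) := by
    have := fun i => nonempty_of_isProbabilityMeasure (μ i)
    exact ⟨fun i => (this i).some⟩
  obtain ⟨x⟩ := hne
  change ∫⁻ a, s.indicator (fun _ => (1 : ENNReal)) a ∂Measure.pi μ = 0
  rw [lintegral_eq_lmarginal_univ x, lmarginal_erase' _ hm (Finset.mem_univ i)]
  simp only [hinner]
  simp [lmarginal]

theorem cost_matrixOf_update_of_notMem {x : {p // p ∉ Z} → ℝ} {p : {p // p ∉ Z}} (u : ℝ)
    {s : Finset (Fin m × Fin n)} (hp : p.1 ∉ s) :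
    cost (matrixOf Z (Function.update x p u)) s = cost (matrixOf Z x) s := by
  refine Finset.sum_congr rfl fun q hq => ?_
  by_cases hqZ : q ∈ Z
  · rw [matrixOf_of_mem hqZ, matrixOf_of_mem hqZ]
  · rw [matrixOf_of_notMem hqZ, matrixOf_of_notMem hqZ, Function.update_of_ne]
    rintro rfl
    exact hp hq

/-- Given all other entries, equality of the costs fixes the entry at `p`, and its law has no atoms.
-/
theorem cost_eq_null {s t : Finset (Fin m × Fin n)} {p : Fin m × Fin n} (hpZ : p ∉ Z)
    (hps : p ∈ s) (hpt : p ∉ t) :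
    ∀ᵐ x ∂entryLaw Z, cost (matrixOf Z x) s ≠ cost (matrixOf Z x) t := by
  rw [ae_iff]
  simp only [ne_eq, not_not]
  refine measure_pi_null_of_section _
    (measurableSet_eq_fun (measurable_cost s) (measurable_cost t)) ⟨p, hpZ⟩ fun x => ?_
  refine measure_mono_null (t := {cost (matrixOf Z x) t - cost (matrixOf Z x) (s.erase p)}) ?_
    (expMeasure_singleton 1 _)
  intro u hu
  have hu : cost (matrixOf Z (Function.update x ⟨p, hpZ⟩ u)) s =
    cost (matrixOf Z (Function.update x ⟨p, hpZ⟩ u)) t := hu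
  rw [← cost_erase hps, cost_matrixOf_update_of_notMem (p := ⟨p, hpZ⟩) u (Finset.notMem_erase p s),
    cost_matrixOf_update_of_notMem (p := ⟨p, hpZ⟩) u hpt, matrixOf_of_notMem hpZ,
    Function.update_self] at hu
  rw [Set.mem_singleton_iff]
  linarith

theorem ae_isGeneric (Z : Finset (Fin m × Fin n)) :
    ∀ᵐ x ∂entryLaw Z, IsGeneric Z (matrixOf Z x) := by
  have hpos : ∀ᵐ x ∂entryLaw Z, ∀ p : {p // p ∉ Z}, 0 < x p := by
    rw [ae_all_iff]
    intro p
    rw [ae_iff]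
    refine measure_pi_null_of_section _ ?_ p fun x => ?_
    · simp only [not_lt]
      exact measurableSet_le (measurable_pi_apply p) measurable_const
    · refine measure_mono_null ?_ (expMeasure_Iic_zero 1)
      intro u hu
      simpa using hu
  have hinj : ∀ᵐ x ∂entryLaw Z, ∀ s t : Finset (Fin m × Fin n), Disjoint s Z → Disjoint t Z →
      s ≠ t → cost (matrixOf Z x) s ≠ cost (matrixOf Z x) t := by
    rw [ae_all_iff]
    intro s
    rw [ae_all_iff]
    intro t
    by_cases hst : s ⊆ t
    · by_cases hts : t ⊆ s
      · exact Filter.Eventually.of_forall fun x _ _ hne => absurd (hst.antisymm hts) hne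
      · obtain ⟨p, hp, hp'⟩ := Finset.not_subset.1 hts
        by_cases hpZ : p ∈ Z
        · exact Filter.Eventually.of_forall fun x _ h =>
            absurd hpZ (Finset.disjoint_left.1 h hp)
        · filter_upwards [cost_eq_null hpZ hp hp'] with x hx _ _ _ using hx.symm
    · obtain ⟨p, hp, hp'⟩ := Finset.not_subset.1 hst
      by_cases hpZ : p ∈ Z
      · exact Filter.Eventually.of_forall fun x h =>
          absurd hpZ (Finset.disjoint_left.1 h hp)
      · filter_upwards [cost_eq_null hpZ hp hp'] with x hx _ _ _ using hx
  filter_upwards [hpos, hinj] with x h1 h2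
  refine ⟨fun p hp => matrixOf_of_mem hp, fun p hp => ?_, fun s t hs ht h => ?_⟩
  · rw [matrixOf_of_notMem hp]
    exact h1 _
  · by_contra hne
    exact h2 s t hs ht hne h

theorem measurableSet_isOptimal (k : ℕ) (s : Finset (Fin m × Fin n)) :
    MeasurableSet {x : {p // p ∉ Z} → ℝ | IsOptimal (matrixOf Z x) k s} := by
  have h : {x : {p // p ∉ Z} → ℝ | IsOptimal (matrixOf Z x) k s} =
      {_x | IsAssignment k s} ∩ ⋂ t : {t // IsAssignment k t},
        {x | cost (matrixOf Z x) s ≤ cost (matrixOf Z x) t.1} := by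
    ext x
    simp [IsOptimal]
  rw [h]
  exact (MeasurableSet.const _).inter
    (MeasurableSet.iInter fun t => measurableSet_le (measurable_cost s) (measurable_cost t.1))

/-- Every event that depends only on which assignments are optimal is measurable. -/
theorem measurableSet_of_optimal (j k : ℕ)
    (Q : (Finset (Fin m × Fin n) → Prop) → (Finset (Fin m × Fin n) → Prop) → Prop) :
    MeasurableSet {x : {p // p ∉ Z} → ℝ |
      Q (IsOptimal (matrixOf Z x) j) (IsOptimal (matrixOf Z x) k)} := by
  have hm : ∀ k, Measurable fun x : {p // p ∉ Z} → ℝ => IsOptimal (matrixOf Z x) k := fun k =>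
    measurable_pi_iff.2 fun s => measurableSet_setOfPred.1 (measurableSet_isOptimal k s)
  exact ((hm j).prodMk (hm k)) (MeasurableSet.of_discrete (s := {q | Q q.1 q.2}))

theorem swap_notMem_iff {F : Finset (Fin m)} {a a' i : Fin m} {b : Fin n} (ha : a ∉ F)
    (ha' : a' ∉ F) (hb : b ∉ zeroCols Z F) :
    (Equiv.swap a a' i, b) ∈ Z ↔ (i, b) ∈ Z := by
  have h : ∀ i ∉ F, (i, b) ∉ Z := fun i hi h => hb (mem_zeroCols.2 ⟨i, hi, h⟩)
  by_cases h1 : i = a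
  · subst h1
    simp [h _ ha, h _ ha']
  by_cases h2 : i = a'
  · subst h2
    simp [h _ ha, h _ ha']
  · rw [Equiv.swap_apply_of_ne_of_ne h1 h2]

/-- Exchanging two rows outside `F` in the columns without zeros outside `F` preserves the law of
the matrix. -/
theorem exists_measurePreserving_swapRows {F : Finset (Fin m)} {a a' : Fin m} (ha : a ∉ F)
    (ha' : a' ∉ F) :
    ∃ T : ({p // p ∉ Z} → ℝ) → ({p // p ∉ Z} → ℝ), MeasurePreserving T (entryLaw Z) (entryLaw Z) ∧
      ∀ x, matrixOf Z (T x) = swapRows (zeroCols Z F) a a' (matrixOf Z x) := by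
  -- An involution of the positions that preserves `Z`, because the columns it affects have no zeros
  -- outside F. The law is a product of identical factors, so permuting coordinates preserves it.
  let θ : Fin m × Fin n → Fin m × Fin n := fun p =>
    if p.2 ∈ zeroCols Z F then p else (Equiv.swap a a' p.1, p.2)
  have hθ : ∀ p ∉ Z, θ p ∉ Z := by
    intro p hp
    by_cases hb : p.2 ∈ zeroCols Z F
    · simpa only [θ, if_pos hb] using hp
    · simpa only [θ, if_neg hb, swap_notMem_iff ha ha' hb] using hp
  have hθθ : ∀ p, θ (θ p) = p := by
    intro p
    by_cases hb : p.2 ∈ zeroCols Z F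
    · simp only [θ, if_pos hb]
    · simp only [θ, if_neg hb, Equiv.swap_apply_self]
  let e : Equiv.Perm {p // p ∉ Z} :=
    Function.Involutive.toPerm (fun p => ⟨θ p.1, hθ p.1 p.2⟩) fun p => Subtype.ext (hθθ p.1)
  refine ⟨_, measurePreserving_piCongrLeft (fun _ : {p // p ∉ Z} => expMeasure 1) e, fun x => ?_⟩
  have hT : ∀ p, MeasurableEquiv.piCongrLeft (fun _ : {p // p ∉ Z} => ℝ) e x p = x (e p) := by
    intro p
    have h := Equiv.piCongrLeft_apply_apply (fun _ : {p // p ∉ Z} => ℝ) e x (e p)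
    rw [show e (e p) = p from Subtype.ext (hθθ p.1)] at h
    exact h
  funext i b
  by_cases hb : b ∈ zeroCols Z F
  · rw [swapRows, if_pos hb]
    by_cases hp : (i, b) ∈ Z
    · rw [matrixOf_of_mem (p := (i, b)) hp, matrixOf_of_mem (p := (i, b)) hp]
    · rw [matrixOf_of_notMem (p := (i, b)) hp, matrixOf_of_notMem (p := (i, b)) hp, hT]
      congr 1
      exact Subtype.ext (if_pos hb)
  · rw [swapRows, if_neg hb]
    have hiff := swap_notMem_iff (i := i) ha ha' hb
    by_cases hp : (i, b) ∈ Z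
    · rw [matrixOf_of_mem (p := (i, b)) hp, matrixOf_of_mem (p := (_, b)) (hiff.2 hp)]
    · rw [matrixOf_of_notMem (p := (i, b)) hp,
        matrixOf_of_notMem (p := (_, b)) (fun h => hp (hiff.1 h)), hT]
      congr 1
      exact Subtype.ext (if_neg hb)

/-- The event that `F` are the common rows of the optimal `j`-assignments, and that an optimal
`(j + 1)`-assignment has a nonzero element in the row `a`. -/
def newRowEvent (Z : Finset (Fin m × Fin n)) (j : ℕ) (F : Finset (Fin m)) (a : Fin m) :
    Set ({p // p ∉ Z} → ℝ) :=
  {x | commonRows (matrixOf Z x) j = F ∧ HasNonzeroInRow (matrixOf Z x) Z (j + 1) a}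

open Classical in
theorem measurableSet_newRowEvent (F : Finset (Fin m)) (a : Fin m) :
    MeasurableSet (newRowEvent Z j F a) :=
  measurableSet_of_optimal j (j + 1) fun o o' =>
    (Finset.univ.filter fun i => ∀ s, o s → UsesRow s i) = F ∧
      ∃ s, o' s ∧ ∃ b, (a, b) ∈ s ∧ (a, b) ∉ Z

theorem measure_newRowEvent_le (hj : j + 1 ≤ min m n)
    (hZ : ∀ s, IsAssignment (j + 1) s → ¬ s ⊆ Z) {F : Finset (Fin m)} {a a' : Fin m} (ha : a ∉ F)
    (ha' : a' ∉ F) :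
    entryLaw Z (newRowEvent Z j F a) ≤ entryLaw Z (newRowEvent Z j F a') := by
  obtain ⟨T, hT, hTm⟩ := exists_measurePreserving_swapRows (Z := Z) ha ha'
  rw [← hT.measure_preimage (measurableSet_newRowEvent F a').nullMeasurableSet]
  refine measure_mono_ae ?_
  filter_upwards [ae_isGeneric Z, hT.quasiMeasurePreserving.ae (ae_isGeneric Z)] with x h1 h2 hx
  obtain ⟨rfl, hnew⟩ := hx
  rw [hTm] at h2
  change T x ∈ newRowEvent Z j _ a'
  rw [newRowEvent, Set.mem_ofPred_eq, hTm]
  exact h1.swapRows_invariant hj hZ ha ha' hnew h2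

/-- By `existsUnique_newRow` the events with `a ∉ F` partition the space up to a null set. -/
theorem integral_eq_sum_newRowEvent (hj : j + 1 ≤ min m n)
    (hZ : ∀ s, IsAssignment (j + 1) s → ¬ s ⊆ Z) (w : Finset (Fin m) → Fin m → ℝ)
    (g : ({p // p ∉ Z} → ℝ) → ℝ)
    (hg : ∀ᵐ x ∂entryLaw Z, ∀ a ∉ commonRows (matrixOf Z x) j,
      HasNonzeroInRow (matrixOf Z x) Z (j + 1) a → g x = w (commonRows (matrixOf Z x) j) a) :
    ∫ x, g x ∂entryLaw Z =
      ∑ F : Finset (Fin m), ∑ a ∈ Fᶜ, (entryLaw Z).real (newRowEvent Z j F a) * w F a := by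
  have h1 : ∫ x, g x ∂entryLaw Z = ∫ x, ∑ F : Finset (Fin m), ∑ a ∈ Fᶜ,
      (newRowEvent Z j F a).indicator (fun _ => w F a) x ∂entryLaw Z := by
    refine integral_congr_ae ?_
    filter_upwards [hg, ae_isGeneric Z] with x hx hgen
    obtain ⟨a, ⟨haF, hnew⟩, huniq⟩ := hgen.existsUnique_newRow hj hZ
    rw [Finset.sum_eq_single (commonRows (matrixOf Z x) j),
      Finset.sum_eq_single_of_mem a (Finset.mem_compl.2 haF), Set.indicator_of_mem, hx a haF hnew]
    · exact ⟨rfl, hnew⟩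
    · intro b hb hne
      refine Set.indicator_of_notMem (fun hmem => hne ?_) _
      exact huniq b ⟨Finset.mem_compl.1 hb, hmem.2⟩
    · intro F _ hne
      refine Finset.sum_eq_zero fun b _ => Set.indicator_of_notMem (fun hmem => hne ?_) _
      exact hmem.1.symm
    · simp
  have hint : ∀ F a, Integrable ((newRowEvent Z j F a).indicator fun _ => w F a) (entryLaw Z) :=
    fun F a => (integrable_const _).indicator (measurableSet_newRowEvent F a)
  rw [h1, integral_finsetSum _ fun F _ => integrable_finsetSum _ fun a _ => hint F a]
  refine Finset.sum_congr rfl fun F _ => ?_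
  rw [integral_finsetSum _ fun a _ => hint F a]
  refine Finset.sum_congr rfl fun a _ => ?_
  rw [integral_indicator_const _ (measurableSet_newRowEvent F a), smul_eq_mul]

/-- Averaging over the new row: it is uniformly distributed outside the common rows. -/
theorem integral_newRow (hj : j + 1 ≤ min m n)
    (hZ : ∀ s, IsAssignment (j + 1) s → ¬ s ⊆ Z) (w : Finset (Fin m) → ℝ)
    (hw : ∀ F : Finset (Fin m), F.card + (zeroCols Z F).card = j →
      ∑ a ∈ Fᶜ, w (insert a F) = Fᶜ.card * w F)
    (g : ({p // p ∉ Z} → ℝ) → ℝ)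
    (hg : ∀ᵐ x ∂entryLaw Z, ∀ a ∉ commonRows (matrixOf Z x) j,
      HasNonzeroInRow (matrixOf Z x) Z (j + 1) a →
        g x = w (insert a (commonRows (matrixOf Z x) j))) :
    ∫ x, g x ∂entryLaw Z = ∫ x, w (commonRows (matrixOf Z x) j) ∂entryLaw Z := by
  rw [integral_eq_sum_newRowEvent hj hZ (fun F a => w (insert a F)) g hg,
    integral_eq_sum_newRowEvent hj hZ (fun F _ => w F) _
      (Filter.Eventually.of_forall fun x a _ _ => rfl)]
  refine Finset.sum_congr rfl fun F _ => ?_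
  by_cases hF : F.card + (zeroCols Z F).card = j
  · rcases Fᶜ.eq_empty_or_nonempty with he | ⟨a₀, ha₀⟩
    · simp [he]
    have hconst : ∀ a ∈ Fᶜ, (entryLaw Z).real (newRowEvent Z j F a) =
        (entryLaw Z).real (newRowEvent Z j F a₀) := by
      intro a ha
      rw [Finset.mem_compl] at ha ha₀
      rw [measureReal_def, measureReal_def]
      exact congrArg _ ((measure_newRowEvent_le hj hZ ha ha₀).antisymm
        (measure_newRowEvent_le hj hZ ha₀ ha))
    rw [Finset.sum_congr rfl fun a ha => by rw [hconst a ha], ← Finset.mul_sum, hw F hF,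
      Finset.sum_congr rfl fun a ha => by rw [hconst a ha], Finset.sum_const, nsmul_eq_mul]
    ring
  -- Sets F with the wrong number of lines almost surely do not occur, so the averaging hypothesis
  -- is not needed for them.
  · have hnull : ∀ a, (entryLaw Z).real (newRowEvent Z j F a) = 0 := by
      intro a
      rw [measureReal_def, ENNReal.toReal_eq_zero_iff]
      left
      rw [measure_eq_zero_iff_ae_notMem]
      filter_upwards [ae_isGeneric Z] with x hx hmem
      have := hx.card_commonRows_add hj hZ
      rw [hmem.1] at this
      exact hF this
    simp [hnull]

end Law

/-! ### The order probability along the growing sizes -/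

section RowProbability

variable {m n : ℕ} {A : Fin m → Fin n → ℝ} {Z : Finset (Fin m × Fin n)} {j k : ℕ} {r : Fin m}

theorem IsGeneric.isOptimal_of_subset (hA : IsGeneric Z A) {t : Finset (Fin m × Fin n)}
    (ht : IsAssignment k t) (htZ : t ⊆ Z) : IsOptimal A k t := by
  refine ⟨ht, fun u _ => ?_⟩
  have h0 : cost A t = 0 := Finset.sum_eq_zero fun p hp => hA.zero p (htZ hp)
  rw [h0]
  exact Finset.sum_nonneg fun p _ => hA.nonneg p

theorem IsGeneric.notMem_commonRows (hA : IsGeneric Z A) {t : Finset (Fin m × Fin n)}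
    (ht : IsAssignment k t) (htZ : t ⊆ Z) (hr : ∀ b, (r, b) ∉ Z) : r ∉ commonRows A k := by
  intro h
  obtain ⟨b, hb⟩ := mem_commonRows.1 h t (hA.isOptimal_of_subset ht htZ)
  exact hr b (htZ hb)

theorem le_card_of_covers {t : Finset (Fin m × Fin n)} (ht : IsAssignment k t) (htZ : t ⊆ Z)
    {R : Finset (Fin m)} {C : Finset (Fin n)} (h : Covers Z R C) : k ≤ R.card + C.card := by
  rw [← ht.card_eq]
  exact card_le_of_covered ht.isMatching fun p hp => h p (htZ hp)

/-- A j-assignment of zeros forces every cover to have at least j lines, so the cover given by the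
common rows is minimal, and uncrossing applies with B = ∅. -/
theorem IsGeneric.orderProb_start (hA : IsGeneric Z A) (hj : j + 1 ≤ min m n)
    (hZ : ∀ s, IsAssignment (j + 1) s → ¬ s ⊆ Z) {t : Finset (Fin m × Fin n)}
    (ht : IsAssignment j t) (htZ : t ⊆ Z) (hr : ∀ b, (r, b) ∉ Z) :
    orderProb Z k r (commonRows A j) = orderProb Z k r ∅ := by
  have hrF := hA.notMem_commonRows ht htZ hr
  have := orderProb_union_eq (Z := Z) (k := k) ∅ (commonRows A j) (r := r)
    (by rwa [Finset.empty_union]) (fun S hS => by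
      rw [Finset.empty_union]
      exact hS.union (Finset.empty_subset _) (covers_zeroCols Z _)
        (hA.card_commonRows_add hj hZ).le fun R C _ hc => le_card_of_covers ht htZ hc)
  rwa [Finset.empty_union] at this

theorem IsGeneric.mem_insert_of_mem_succ (hA : IsGeneric Z A) (hj : j + 1 ≤ min m n)
    (hZ : ∀ s, IsAssignment (j + 1) s → ¬ s ⊆ Z) (hr : ∀ b, (r, b) ∉ Z) {a : Fin m}
    (ha : a ∉ commonRows A j) (hnew : HasNonzeroInRow A Z (j + 1) a)
    (h : r ∈ commonRows A (j + 1)) : r ∈ insert a (commonRows A j) := by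
  by_cases hrj : r ∈ commonRows A j
  · exact Finset.mem_insert_of_mem hrj
  · rw [(hA.existsUnique_newRow hj hZ).unique
      ⟨hrj, hasNonzeroInRow_of_mem_commonRows hj hr h⟩ ⟨ha, hnew⟩]
    exact Finset.mem_insert_self _ _

theorem IsGeneric.insert_subset_succ (hA : IsGeneric Z A) (hj : j + 1 ≤ min m n)
    (hZ : ∀ s, IsAssignment (j + 1) s → ¬ s ⊆ Z) {a : Fin m}
    (hnew : HasNonzeroInRow A Z (j + 1) a) :
    insert a (commonRows A j) ⊆ commonRows A (j + 1) :=
  Finset.insert_subset (hA.mem_commonRows_of_hasNonzero hnew) (hA.commonRows_subset_succ hj hZ)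

/-- Covers containing the old common rows and `a` have at least j + 1 lines, and the new common rows
attain this, so uncrossing applies. If `r` is a new common row, it can only be `a`, having no zeros.
-/
theorem IsGeneric.orderProb_succ (hA : IsGeneric Z A) (hj : j + 2 ≤ min m n)
    (hZ : ∀ s, IsAssignment (j + 1) s → ¬ s ⊆ Z) (hr : ∀ b, (r, b) ∉ Z) {a : Fin m}
    (ha : a ∉ commonRows A j) (hnew : HasNonzeroInRow A Z (j + 1) a) :
    orderProb Z k r (commonRows A (j + 1)) = orderProb Z k r (insert a (commonRows A j)) := by
  have hj' : j + 1 ≤ min m n := by omega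
  have hsub := hA.insert_subset_succ hj' hZ hnew
  by_cases hrF : r ∈ commonRows A (j + 1)
  · rw [orderProb_of_mem hrF,
      orderProb_of_mem (hA.mem_insert_of_mem_succ hj' hZ hr ha hnew hrF)]
  · have h := orderProb_union_eq (Z := Z) (k := k) (insert a (commonRows A j))
      (commonRows A (j + 1)) (r := r) (by rwa [Finset.union_eq_right.2 hsub]) (fun S hS => by
        rw [Finset.union_eq_right.2 hsub]
        exact hS.union hsub (covers_zeroCols Z _)
          (hA.card_commonRows_add hj (not_subset_of_le (Nat.le_succ _) hZ)).le
          fun R C hR hc => hA.lt_card_cover ha ((Finset.subset_insert _ _).trans hR)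
            (hR (Finset.mem_insert_self _ _)) hc)
    rwa [Finset.union_eq_right.2 hsub] at h

open Classical in
theorem IsGeneric.orderProb_last (hA : IsGeneric Z A) (hj : j + 1 ≤ min m n)
    (hZ : ∀ s, IsAssignment (j + 1) s → ¬ s ⊆ Z) (hr : ∀ b, (r, b) ∉ Z) {a : Fin m}
    (ha : a ∉ commonRows A j) (hnew : HasNonzeroInRow A Z (j + 1) a) :
    (if r ∈ commonRows A (j + 1) then 1 else 0) =
      orderProb Z (j + 1) r (insert a (commonRows A j)) := by
  by_cases hrF : r ∈ commonRows A (j + 1)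
  · rw [if_pos hrF, orderProb_of_mem (hA.mem_insert_of_mem_succ hj hZ hr ha hnew hrF)]
  · rw [if_neg hrF, orderProb_of_not fun h => hrF (hA.insert_subset_succ hj hZ hnew h)]
    rintro ⟨R, C, hR, hc, hcard⟩
    have := hA.lt_card_cover ha ((Finset.subset_insert _ _).trans hR)
      (hR (Finset.mem_insert_self _ _)) hc
    omega

theorem hasSmallCover_of_card {F : Finset (Fin m)} (h : F.card + (zeroCols Z F).card = j)
    (hjk : j < k) : HasSmallCover Z k F :=
  ⟨F, _, Finset.Subset.refl F, covers_zeroCols Z F, by omega⟩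

theorem integral_orderProb {t₀ : ℕ} {t : Finset (Fin m × Fin n)} (ht : IsAssignment t₀ t)
    (htZ : t ⊆ Z) (hZ : ∀ s, IsAssignment (t₀ + 1) s → ¬ s ⊆ Z) (hk : k ≤ min m n)
    (hr : ∀ b, (r, b) ∉ Z) (d : ℕ) (hd : t₀ + d < k) :
    ∫ x, orderProb Z k r (commonRows (matrixOf Z x) (t₀ + d)) ∂entryLaw Z =
      orderProb Z k r ∅ := by
  induction d with
  | zero =>
    rw [integral_congr_ae (g := fun _ => orderProb Z k r ∅)]
    · simp
    · filter_upwards [ae_isGeneric Z] with x hx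
      exact hx.orderProb_start (by omega) hZ ht htZ hr
  | succ d ih =>
    rw [← ih (by omega)]
    have hZ' := not_subset_of_le (show t₀ + 1 ≤ t₀ + d + 1 by omega) hZ
    refine integral_newRow (j := t₀ + d) (by omega) hZ' _ (fun F hF =>
      sum_orderProb_insert F (hasSmallCover_of_card hF (by omega))) _ ?_
    filter_upwards [ae_isGeneric Z] with x hx a ha hnew
    exact hx.orderProb_succ (by omega) hZ' hr ha hnew

theorem measurableSet_mem_commonRows (k : ℕ) (r : Fin m) :
    MeasurableSet {x : {p // p ∉ Z} → ℝ | r ∈ commonRows (matrixOf Z x) k} := by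
  simp only [mem_commonRows]
  exact measurableSet_of_optimal k k fun o _ => ∀ s, o s → UsesRow s r

theorem exists_max_zero_assignment (h : ∀ s, IsAssignment k s → ¬ s ⊆ Z) :
    ∃ t₀ < k, (∃ t ⊆ Z, IsAssignment t₀ t) ∧ ∀ s, IsAssignment (t₀ + 1) s → ¬ s ⊆ Z := by
  classical
  have hex : ∃ l, ∀ s, IsAssignment l s → ¬ s ⊆ Z := ⟨k, h⟩
  have hle := Nat.find_min' hex h
  have hspec := Nat.find_spec hex
  obtain ⟨l, hl⟩ : ∃ l, Nat.find hex = l + 1 := by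
    refine Nat.exists_eq_succ_of_ne_zero fun h0 => ?_
    rw [h0] at hspec
    exact hspec ∅ ⟨rfl, by simp, by simp⟩ (Finset.empty_subset _)
  rw [hl] at hspec hle
  refine ⟨l, by omega, ?_, hspec⟩
  have := Nat.find_min hex (m := l) (by omega)
  push Not at this
  obtain ⟨t, ht, htZ⟩ := this
  exact ⟨t, htZ, ht⟩

/-- The probability that a zero-free row is used by all optimal `k`-assignments. -/
theorem entryLaw_mem_commonRows (hk : k ≤ min m n) (hr : ∀ b, (r, b) ∉ Z) :
    (entryLaw Z).real {x | r ∈ commonRows (matrixOf Z x) k} = orderProb Z k r ∅ := by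
  classical
  by_cases h : ∀ s, IsAssignment k s → ¬ s ⊆ Z
  · obtain ⟨t₀, ht₀, ⟨t, htZ, ht⟩, hZ⟩ := exists_max_zero_assignment h
    obtain ⟨d, rfl⟩ : ∃ d, k = t₀ + d + 1 := ⟨k - t₀ - 1, by omega⟩
    rw [← integral_orderProb ht htZ hZ hk hr d (by omega),
      ← integral_newRow (j := t₀ + d) hk h _ (fun F hF =>
        sum_orderProb_insert F (hasSmallCover_of_card hF (by omega)))
        (fun x => if r ∈ commonRows (matrixOf Z x) (t₀ + d + 1) then 1 else 0) (by
          filter_upwards [ae_isGeneric Z] with x hx a ha hnew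
          exact hx.orderProb_last hk h hr ha hnew),
      ← integral_indicator_one (measurableSet_mem_commonRows _ r)]
    refine integral_congr_ae (Filter.Eventually.of_forall fun x => ?_)
    simp [Set.indicator_apply]
  -- If `Z` contains a k-assignment, it is optimal and avoids `r`, and no cover has fewer than k
  -- lines: both sides are 0.
  · push Not at h
    obtain ⟨t, ht, htZ⟩ := h
    rw [orderProb_of_not (Finset.notMem_empty r)]
    · rw [measureReal_def, ENNReal.toReal_eq_zero_iff]
      left
      rw [measure_eq_zero_iff_ae_notMem]
      filter_upwards [ae_isGeneric Z] with x hx using hx.notMem_commonRows ht htZ hr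
    · rintro ⟨R, C, -, hc, hcard⟩
      have := le_card_of_covers ht htZ hc
      omega

/-! ### Transfer to the given probability space -/

variable {Ω : Type*} [MeasurableSpace Ω] {μ : Measure Ω} {X : Fin m → Fin n → Ω → ℝ}

theorem IsStandardRAP.hasLaw_entries [IsProbabilityMeasure μ] (hP : IsStandardRAP μ k Z X) :
    HasLaw (fun ω (p : {p // p ∉ Z}) => X p.1.1 p.1.2 ω) (entryLaw Z) μ := by
  have hm : ∀ p : {p // p ∉ Z}, AEMeasurable (X p.1.1 p.1.2) μ := fun p =>
    (hP.law p.1 p.2).aemeasurable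
  refine ⟨aemeasurable_pi_iff.2 hm, ?_⟩
  rw [(iIndepFun_iff_map_fun_eq_pi_map hm).1 hP.indep, entryLaw]
  congr 1
  funext p
  exact (hP.law p.1 p.2).map_eq

theorem IsStandardRAP.ae_eq_matrixOf (hP : IsStandardRAP μ k Z X) :
    ∀ᵐ ω ∂μ, (fun i j => X i j ω) = matrixOf Z fun p => X p.1.1 p.1.2 ω := by
  have h : ∀ᵐ ω ∂μ, ∀ p : Fin m × Fin n, p ∈ Z → X p.1 p.2 ω = 0 := by
    rw [ae_all_iff]
    intro p
    by_cases hp : p ∈ Z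
    · filter_upwards [hP.zero p hp] with ω hω _ using hω
    · exact Filter.Eventually.of_forall fun ω h => absurd h hp
  filter_upwards [h] with ω hω
  funext i j
  by_cases hp : (i, j) ∈ Z
  · rw [matrixOf_of_mem (p := (i, j)) hp]
    exact hω (i, j) hp
  · rw [matrixOf_of_notMem (p := (i, j)) hp]

theorem IsStandardRAP.ae_isGeneric [IsProbabilityMeasure μ] (hP : IsStandardRAP μ k Z X) :
    ∀ᵐ ω ∂μ, IsGeneric Z fun i j => X i j ω := by
  have h := RandomAssignment.ae_isGeneric Z
  rw [← hP.hasLaw_entries.map_eq] at h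
  filter_upwards [ae_of_ae_map hP.hasLaw_entries.aemeasurable h, hP.ae_eq_matrixOf] with ω h1 h2
  rw [h2]
  exact h1

theorem IsStandardRAP.measure_mem_commonRows [IsProbabilityMeasure μ]
    (hP : IsStandardRAP μ k Z X) (hr : ∀ b, (r, b) ∉ Z) :
    μ.real {ω | r ∈ commonRows (fun i j => X i j ω) k} = orderProb Z k r ∅ := by
  rw [← entryLaw_mem_commonRows hP.le_min hr,
    ← hP.hasLaw_entries.measureReal_eq (measurableSet_mem_commonRows k r)]
  refine measureReal_congr ?_
  filter_upwards [hP.ae_eq_matrixOf] with ω hω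
  change (r ∈ commonRows (fun i j => X i j ω) k) = _
  rw [hω]
  rfl

theorem IsGeneric.exists_usesRow_iff (hA : IsGeneric Z A) (hk : k ≤ min m n)
    (hr : ∀ b, (r, b) ∉ Z) :
    (∃ s, IsOptimal A k s ∧ UsesRow s r) ↔ r ∈ commonRows A k := by
  constructor
  · rintro ⟨s, hs, b, hb⟩
    exact hA.mem_commonRows_of_mem hs hb (hr b)
  · intro h
    obtain ⟨s, hs⟩ := exists_isOptimal A hk
    exact ⟨s, hs, mem_commonRows.1 h s hs⟩

end RowProbability

end RandomAssignment

theorem theoremT {Ω : Type*} [MeasurableSpace Ω] (μ : Measure Ω) [IsProbabilityMeasure μ]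
    (m n k : ℕ) (Z : Finset (Fin m × Fin n)) (X : Fin m → Fin n → Ω → ℝ)
    (hP : RandomAssignment.IsStandardRAP μ k Z X)
    (r : Fin m) (hr : ∀ j : Fin n, (r, j) ∉ Z) :
    μ.real {ω | ∃ s, RandomAssignment.IsOptimal (fun i j => X i j ω) k s ∧
        RandomAssignment.UsesRow s r} =
      1 / (m : ℝ) * ∑ i ∈ Finset.range k,
        (RandomAssignment.coverCoeffAvoiding Z k r i 0 : ℝ) / ((m - 1).choose i : ℝ) ∧
    μ.real {ω | ∀ s, RandomAssignment.IsOptimal (fun i j => X i j ω) k s →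
        RandomAssignment.UsesRow s r} =
      1 / (m : ℝ) * ∑ i ∈ Finset.range k,
        (RandomAssignment.coverCoeffAvoiding Z k r i 0 : ℝ) / ((m - 1).choose i : ℝ) := by
  rw [← RandomAssignment.orderProb_empty (hP.le_min.trans (min_le_left m n)) r,
    ← hP.measure_mem_commonRows hr]
  constructor
  · refine measureReal_congr ?_
    filter_upwards [hP.ae_isGeneric] with ω hω
    exact propext (hω.exists_usesRow_iff hP.le_min hr)
  · simp only [RandomAssignment.mem_commonRows]
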